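/- Let $\kappa$ be an infinite regular cardinal and let $\mathcal C$ be a small $\kappa$-lex category (a category with all $\kappa$-small limits). A functor is $\kappa$-lex if it preserves $\kappa$-small limits, and $\mathbf{Lex}_\kappa(\mathcal C,\mathbf{Set})$ is the category of $\kappa$-lex functors $\mathcal C\to\mathbf{Set}$ and natural transformations. Let $\mathcal C\downarrow\mathbf{Lex}_\kappa^{\sim}$ be the $(2,1)$-category whose objects are $\kappa$-lex functors $M:\mathcal C\to\mathcal D$ with $\mathcal D$ small and $\kappa$-lex, whose 1-cells from $M:\mathcal C\to\mathcal D$ to $N:\mathcal C\to\mathcal D'$ are pairs $(F,\nu_F)$ of a $\kappa$-lex functor $F:\mathcal D\to\mathcal D'$ and a natural isomorphism $\nu_F:FM\Rightarrow N$, and whose 2-cells $(F,\nu_F)\Rightarrow(G,\nu_G)$ are the natural isomorphisms $\theta:F\Rightarrow G$ with $\nu_G\circ\theta M=\nu_F$. Let $$\Gamma:\mathcal C\downarrow\mathbf{Lex}_\kappa^{\sim}\to\mathbf{Lex}_\kappa(\mathcal C,\mathbf{Set})$$ be the pseudofunctor sending $M:\mathcal C\to\mathcal D$ to $\mathcal D(1_{\mathcal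 D},-)\circ M$ and $(F,\nu_F)$ to the natural transformation with components $s\mapsto \nu_{F,x}\circ F(s)\circ(1_{\mathcal D'}\cong F1_{\mathcal D})$, where $\mathbf{Lex}_\kappa(\mathcal C,\mathbf{Set})$ is regarded as a 2-category with only identity 2-cells. Then there is a pseudofunctor $$\mathcal C_{-}:\mathbf{Lex}_\kappa(\mathcal C,\mathbf{Set})\to\mathcal C\downarrow\mathbf{Lex}_\kappa^{\sim},\qquad K\mapsto(\varphi_K:\mathcal C\to\mathcal C_K),$$ of the following form. The category $\mathcal C_K$ is the 2-colimit in $\mathbf{Cat}$, over $(x,a)\in(\int K)^{op}$ (the opposite of the category of elements of $K$), of the slices $\mathcal C/x$ with the pullback functors $f^{-1}:\mathcal C/y\to\mathcal C/x$ for $f:(x,a)\to(y,b)$ in $\int K$, with cocone maps $\varphi_K^{(x,a)}:\mathcal C/x\to\mathcal C_K$. The functor $\varphi_K$ is (up to isomorphism) $\mathcal C\simeq\mathcal C/1\xrightarrow{\varphi_K^{(1,*)}}\mathcal C_K$, where $*$ is the unique element of $K(1)$. For $\alpha:K\Rightarrow K'$ the functor $\mathcal C_\alpha:\mathcal C_K\to\mathcal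 C_{K'}$ is the one induced by the pseudococone $(\varphi_{K'}^{(x,\alpha_x(a))})_{(x,a)}$, and its structure isomorphism $\mathcal C_\alpha\varphi_K\cong\varphi_{K'}$ is the $(1,*)$-component of the corresponding isomorphism of pseudococones. Moreover: 1. $\mathcal C_{-}$ is left adjoint to $\Gamma$ in the $(2,1)$-categorical sense: there are equivalences of groupoids $$\mathcal C\downarrow\mathbf{Lex}_\kappa^{\sim}\bigl(\varphi_K,\,M\bigr)\;\simeq\;\mathrm{Nat}(K,\Gamma M),$$ natural in $K$ and in $M$, where the set $\mathrm{Nat}(K,\Gamma M)$ is regarded as a discrete groupoid. 2. $\Gamma\circ\mathcal C_{-}$ is naturally isomorphic to the identity functor of $\mathbf{Lex}_\kappa(\mathcal C,\mathbf{Set})$; more precisely, the unit $K\Rightarrow\Gamma\varphi_K$ of the adjunction is a natural isomorphism. 3. Consequently $\mathcal C_{-}$ exhibits $\mathbf{Lex}_\kappa(\mathcal C,\mathbf{Set})$ as a full coreflective subcategory of $\mathcal C\downarrow\mathbf{Lex}_\kappa^{\sim}$: for all $K,K'$ the functor from the discrete category $\mathrm{Nat}(K,K')$ to the groupoid $\mathcal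 C\downarrow\mathbf{Lex}_\kappa^{\sim}(\varphi_K,\varphi_{K'})$ given by $\mathcal C_{-}$ is an equivalence. -/

import Mathlib

open CategoryTheory CategoryTheory.Limits CategoryTheory.Bicategory

universe w v₁ v₂ v₃ u u₁ u₂ u₃

noncomputable section

namespace Diagrams

/-! ### `κ`-lex categories and `κ`-lex functors -/

/-- A category is `κ`-lex if it has all `κ`-small limits, a diagram being `κ`-small
when its shape has fewer than `κ` arrows. -/
def IsLexCategory (κ : Cardinal.{w}) (C : Type u₁) [Category.{v₁} C] : Prop :=
  ∀ (J : Type w) [SmallCategory J], HasCardinalLT (Arrow J) κ → HasLimitsOfShape J C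

/-- A functor is `κ`-lex if it preserves all `κ`-small limits. -/
def IsLexFunctor (κ : Cardinal.{w}) {C : Type u₁} [Category.{v₁} C]
    {D : Type u₂} [Category.{v₂} D] (F : C ⥤ D) : Prop :=
  ∀ (J : Type w) [SmallCategory J], HasCardinalLT (Arrow J) κ → PreservesLimitsOfShape J F

lemma IsLexFunctor.id (κ : Cardinal.{w}) (C : Type u₁) [Category.{v₁} C] :
    IsLexFunctor κ (𝟭 C) :=
  fun _ _ _ ↦ inferInstance

lemma IsLexFunctor.comp {κ : Cardinal.{w}} {C : Type u₁} [Category.{v₁} C]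
    {D : Type u₂} [Category.{v₂} D] {E : Type u₃} [Category.{v₃} E]
    {F : C ⥤ D} {G : D ⥤ E} (hF : IsLexFunctor κ F) (hG : IsLexFunctor κ G) :
    IsLexFunctor κ (F ⋙ G) := fun J _ hJ ↦ by
  have := hF J hJ
  have := hG J hJ
  infer_instance

lemma hasCardinalLT_arrow_of_fin {κ : Cardinal.{w}} [hκ : Fact κ.IsRegular]
    (J : Type w) [SmallCategory J] [FinCategory J] : HasCardinalLT (Arrow J) κ :=
  HasCardinalLT.of_le (hasCardinalLT_aleph0_iff _ |>.2 inferInstance) hκ.out.aleph0_le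

lemma IsLexCategory.hasFiniteLimits {κ : Cardinal.{w}} [Fact κ.IsRegular]
    {C : Type u₁} [Category.{v₁} C] (hC : IsLexCategory κ C) : HasFiniteLimits C :=
  hasFiniteLimits_of_hasFiniteLimits_of_size C
    (fun J _ _ ↦ hC J (hasCardinalLT_arrow_of_fin J))

lemma IsLexFunctor.preservesTerminal {κ : Cardinal.{w}} [Fact κ.IsRegular]
    {C : Type u₁} [Category.{v₁} C] {D : Type u₂} [Category.{v₂} D]
    {F : C ⥤ D} (hF : IsLexFunctor κ F) : PreservesLimit (Functor.empty.{0} C) F := by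
  have := hF (Discrete PEmpty.{w + 1}) (hasCardinalLT_arrow_of_fin _)
  have : PreservesLimitsOfShape (Discrete PEmpty.{1}) F :=
    preservesLimitsOfShape_of_equiv (Discrete.equivalence (Equiv.equivOfIsEmpty PEmpty.{w + 1} PEmpty.{1})) F
  infer_instance

/-- The category `Lex_κ(C, Set)`: the full subcategory of `C ⥤ Type u` on the `κ`-lex functors. -/
abbrev LexFun (κ : Cardinal.{u}) (C : Type u) [SmallCategory C] : Type (u + 1) :=
  ObjectProperty.FullSubcategory (fun K : C ⥤ Type u ↦ IsLexFunctor κ K)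

/-- A small `κ`-lex category, i.e. an object of `Lex_κ^∼`. -/
structure LexCat (κ : Cardinal.{u}) : Type (u + 1) where
  carrier : Type u
  [str : SmallCategory carrier]
  isLex : IsLexCategory κ carrier

namespace LexCat

instance (κ : Cardinal.{u}) : CoeSort (LexCat κ) (Type u) := ⟨LexCat.carrier⟩

attribute [instance] LexCat.str

instance {κ : Cardinal.{u}} [Fact κ.IsRegular] (C : LexCat κ) : HasFiniteLimits C :=
  C.isLex.hasFiniteLimits

end LexCat

/-! ### The coslice `C ↓ Lex_κ^∼` as a bicategory with invertible 2-cells -/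

/-- The objects of the coslice: `κ`-lex functors `C ⥤ D` with `D` small and `κ`-lex. -/
structure Coslice {κ : Cardinal.{u}} (C : LexCat κ) : Type (u + 1) where
  cod : LexCat κ
  functor : C ⥤ cod
  isLex : IsLexFunctor κ functor

namespace Coslice

variable {κ : Cardinal.{u}} {C : LexCat κ}

/-- The 1-cells from `M : C ⥤ D` to `N : C ⥤ D'`: a `κ`-lex functor `F : D ⥤ D'` together
with a natural isomorphism `ν : M ⋙ F ≅ N`. -/
structure Hom (M N : Coslice C) : Type u where
  functor : M.cod ⥤ N.cod
  isLex : IsLexFunctor κ functor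
  ν : M.functor ⋙ functor ≅ N.functor

/-- The 2-cells from `(F, ν_F)` to `(G, ν_G)`: a natural isomorphism `θ : F ≅ G` such that
`ν_G ∘ θ M = ν_F`. -/
@[ext]
structure Hom₂ {M N : Coslice C} (F G : Hom M N) : Type u where
  iso : F.functor ≅ G.functor
  w : Functor.whiskerLeft M.functor iso.hom ≫ G.ν.hom = F.ν.hom

@[simp]
lemma Hom₂.w_app {M N : Coslice C} {F G : Hom M N} (θ : Hom₂ F G) (x : C) :
    θ.iso.hom.app (M.functor.obj x) ≫ G.ν.hom.app x = F.ν.hom.app x :=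
  NatTrans.congr_app θ.w x

instance : CategoryStruct (Coslice C) where
  Hom := Hom
  id M := ⟨𝟭 _, IsLexFunctor.id _ _, M.functor.rightUnitor⟩
  comp F G := ⟨F.functor ⋙ G.functor, F.isLex.comp G.isLex,
    (Functor.associator _ _ _).symm ≪≫ Functor.isoWhiskerRight F.ν G.functor ≪≫ G.ν⟩

instance (M N : Coslice C) : Category (M ⟶ N) where
  Hom F G := Hom₂ F G
  id F := ⟨Iso.refl _, by ext; simp⟩
  comp θ η := ⟨θ.iso ≪≫ η.iso, by ext; simp⟩

@[simp] lemma id_functor (M : Coslice C) : Hom.functor (𝟙 M) = 𝟭 _ := rfl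

@[simp] lemma id_ν (M : Coslice C) : Hom.ν (𝟙 M) = M.functor.rightUnitor := rfl

@[simp] lemma comp_functor {M N P : Coslice C} (F : M ⟶ N) (G : N ⟶ P) :
    Hom.functor (F ≫ G) = F.functor ⋙ G.functor := rfl

@[simp] lemma comp_ν_hom_app {M N P : Coslice C} (F : M ⟶ N) (G : N ⟶ P) (x : C) :
    (Hom.ν (F ≫ G)).hom.app x = G.functor.map (F.ν.hom.app x) ≫ G.ν.hom.app x := by
  change 𝟙 _ ≫ _ ≫ _ = _
  simp

@[simp] lemma id_iso {M N : Coslice C} (F : M ⟶ N) : Hom₂.iso (𝟙 F) = Iso.refl _ := rfl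

@[simp] lemma comp_iso {M N : Coslice C} {F G H : M ⟶ N} (θ : F ⟶ G) (η : G ⟶ H) :
    Hom₂.iso (θ ≫ η) = θ.iso ≪≫ η.iso := rfl

@[ext]
lemma hom₂_ext {M N : Coslice C} {F G : M ⟶ N} {θ η : F ⟶ G}
    (h : ∀ d : M.cod, θ.iso.hom.app d = η.iso.hom.app d) : θ = η :=
  Hom₂.ext (Iso.ext (NatTrans.ext (funext h)))

/-- A natural isomorphism compatible with the structure isomorphisms is an invertible 2-cell. -/
def mkIso {M N : Coslice C} {F G : M ⟶ N} (e : F.functor ≅ G.functor)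
    (w : ∀ x : C, e.hom.app (M.functor.obj x) ≫ G.ν.hom.app x = F.ν.hom.app x) : F ≅ G where
  hom := ⟨e, by ext x; exact w x⟩
  inv := ⟨e.symm, by ext x; simp [← w x]⟩
  hom_inv_id := by ext; simp
  inv_hom_id := by ext; simp

@[simp] lemma mkIso_hom_iso {M N : Coslice C} {F G : M ⟶ N} (e : F.functor ≅ G.functor) (w) :
    (mkIso (F := F) (G := G) e w).hom.iso = e := rfl

@[simp] lemma mkIso_inv_iso {M N : Coslice C} {F G : M ⟶ N} (e : F.functor ≅ G.functor) (w) :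
    (mkIso (F := F) (G := G) e w).inv.iso = e.symm := rfl

/-- Left whiskering of 2-cells. -/
def whiskerL {M N P : Coslice C} (F : M ⟶ N) {G H : N ⟶ P} (θ : G ⟶ H) : F ≫ G ⟶ F ≫ H :=
  Hom₂.mk (F := F ≫ G) (G := F ≫ H) (Functor.isoWhiskerLeft F.functor θ.iso) (by
    ext x
    have h := θ.iso.hom.naturality_assoc (F.ν.hom.app x) (H.ν.hom.app x)
    simpa using h.symm)

/-- Right whiskering of 2-cells. -/
def whiskerR {M N P : Coslice C} {F G : M ⟶ N} (θ : F ⟶ G) (H : N ⟶ P) : F ≫ H ⟶ G ≫ H :=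
  Hom₂.mk (F := F ≫ H) (G := G ≫ H) (Functor.isoWhiskerRight θ.iso H.functor) (by
    ext x
    have h := congrArg (fun f ↦ H.functor.map f ≫ H.ν.hom.app x) (θ.w_app x)
    simpa only [Functor.map_comp, Category.assoc, NatTrans.comp_app, Functor.whiskerLeft_app,
      Functor.isoWhiskerRight_hom, Functor.whiskerRight_app, comp_ν_hom_app] using h)

@[simp] lemma whiskerL_iso {M N P : Coslice C} (F : M ⟶ N) {G H : N ⟶ P} (θ : G ⟶ H) :
    (whiskerL F θ).iso = Functor.isoWhiskerLeft F.functor θ.iso := rfl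

@[simp] lemma whiskerR_iso {M N P : Coslice C} {F G : M ⟶ N} (θ : F ⟶ G) (H : N ⟶ P) :
    (whiskerR θ H).iso = Functor.isoWhiskerRight θ.iso H.functor := rfl

instance : Bicategory (Coslice C) where
  whiskerLeft F _ _ θ := whiskerL F θ
  whiskerRight θ H := whiskerR θ H
  associator F G H := mkIso (F := (F ≫ G) ≫ H) (G := F ≫ G ≫ H)
    (Functor.associator _ _ _) (by intro x; simp)
  leftUnitor {M _} F := mkIso (F := 𝟙 M ≫ F) (G := F) (Functor.leftUnitor _) (by intro x; simp)
  rightUnitor {_ N} F := mkIso (F := F ≫ 𝟙 N) (G := F) (Functor.rightUnitor _)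
    (by intro x; simp)

/-- All 2-cells of the coslice are invertible: it is a (2,1)-category. -/
instance : IsLocallyGroupoid (Coslice C) := fun _ _ ↦
  { all_isIso := fun {F G} θ ↦
      (mkIso (F := F) (G := G) θ.iso (fun x ↦ θ.w_app x)).isIso_hom }

end Coslice

/-! ### The global sections functor `Γ` -/

section Gamma

variable {κ : Cardinal.{u}} [Fact κ.IsRegular] {C : LexCat κ}

/-- `Γ M = D(1, -) ∘ M` for a `κ`-lex functor `M : C ⥤ D`. -/
def gammaObj (M : Coslice C) : LexFun κ C where
  obj := M.functor ⋙ coyoneda.obj (.op (⊤_ M.cod))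
  property := M.isLex.comp fun _ _ _ ↦ inferInstance

/-- The canonical map `1 ⟶ F 1` (an isomorphism) for a `κ`-lex functor `F`. -/
def terminalMap {M N : Coslice C} (F : M ⟶ N) : ⊤_ N.cod ⟶ F.functor.obj (⊤_ M.cod) :=
  haveI := F.isLex.preservesTerminal
  (PreservesTerminal.iso F.functor).inv

lemma terminalMap_ext {M N : Coslice C} (F : M ⟶ N) {d : N.cod}
    (f g : d ⟶ F.functor.obj (⊤_ M.cod)) : f = g := by
  have := F.isLex.preservesTerminal
  exact (IsTerminal.isTerminalObj F.functor _ terminalIsTerminal).hom_ext _ _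

/-- `Γ` on a 1-cell `(F, ν) : M ⟶ N`: it sends `s : 1 ⟶ M x` to the composite
`1 ≅ F 1 ⟶ F (M x) ≅ N x` of `F s` with the canonical isomorphisms. -/
def gammaMap {M N : Coslice C} (F : M ⟶ N) : gammaObj M ⟶ gammaObj N :=
  ObjectProperty.homMk
    { app := fun x ↦ ↾fun (s : ⊤_ M.cod ⟶ M.functor.obj x) ↦
        (terminalMap F ≫ F.functor.map s ≫ F.ν.hom.app x : ⊤_ N.cod ⟶ N.functor.obj x)
      naturality := fun x y f ↦ by
        ext (s : ⊤_ M.cod ⟶ M.functor.obj x)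
        change terminalMap F ≫ F.functor.map (s ≫ M.functor.map f) ≫ F.ν.hom.app y =
          (terminalMap F ≫ F.functor.map s ≫ F.ν.hom.app x) ≫ N.functor.map f
        have h := F.ν.hom.naturality f
        simp only [Functor.comp_map] at h
        simp [h] }

lemma gammaMap_app {M N : Coslice C} (F : M ⟶ N) (x : C) (s : ⊤_ M.cod ⟶ M.functor.obj x) :
    (gammaMap F).hom.app x s = terminalMap F ≫ F.functor.map s ≫ F.ν.hom.app x := rfl

lemma gamma_hom_ext {K : LexFun κ C} {N : Coslice C} {f g : K ⟶ gammaObj N}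
    (h : ∀ (x : C) (s : K.obj.obj x), f.hom.app x s = g.hom.app x s) : f = g := by
  ext x s
  exact h x s

lemma gammaMap_id (M : Coslice C) : gammaMap (𝟙 M) = 𝟙 (gammaObj M) := by
  refine gamma_hom_ext fun x (s : ⊤_ M.cod ⟶ M.functor.obj x) ↦ ?_
  change terminalMap (𝟙 M) ≫ s ≫ 𝟙 _ = s
  rw [terminalMap_ext (𝟙 M) (terminalMap (𝟙 M)) (𝟙 (⊤_ M.cod))]
  exact (Category.id_comp _).trans (Category.comp_id _)

lemma gammaMap_comp {M N P : Coslice C} (F : M ⟶ N) (G : N ⟶ P) :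
    gammaMap (F ≫ G) = gammaMap F ≫ gammaMap G := by
  refine gamma_hom_ext fun x (s : ⊤_ M.cod ⟶ M.functor.obj x) ↦ ?_
  change terminalMap (F ≫ G) ≫ G.functor.map (F.functor.map s) ≫ (Coslice.Hom.ν (F ≫ G)).hom.app x =
    terminalMap G ≫
      G.functor.map (terminalMap F ≫ F.functor.map s ≫ F.ν.hom.app x) ≫ G.ν.hom.app x
  rw [terminalMap_ext (F ≫ G) (terminalMap (F ≫ G))
    (terminalMap G ≫ G.functor.map (terminalMap F))]
  simp

lemma gammaMap_congr {M N : Coslice C} {F G : M ⟶ N} (θ : F ⟶ G) : gammaMap F = gammaMap G := by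
  refine gamma_hom_ext fun x (s : ⊤_ M.cod ⟶ M.functor.obj x) ↦ ?_
  change terminalMap F ≫ F.functor.map s ≫ F.ν.hom.app x =
    terminalMap G ≫ G.functor.map s ≫ G.ν.hom.app x
  rw [terminalMap_ext G (terminalMap G) (terminalMap F ≫ θ.iso.hom.app _), ← θ.w_app x]
  have h := θ.iso.hom.naturality_assoc s (G.ν.hom.app x)
  rw [h, Category.assoc]

/-- The pseudofunctor `Γ : C ↓ Lex_κ^∼ ⥤ Lex_κ(C, Set)`; the 2-cells of the target are
identities. -/
def gamma (C : LexCat κ) : Coslice C ⥤ᵖ LocallyDiscrete (LexFun κ C) where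
  obj M := ⟨gammaObj M⟩
  map F := ⟨gammaMap F⟩
  map₂ θ := Discrete.eqToHom (gammaMap_congr θ)
  mapId M := Discrete.eqToIso (gammaMap_id M)
  mapComp F G := Discrete.eqToIso (gammaMap_comp F G)
  map₂_id _ := Subsingleton.elim _ _
  map₂_comp _ _ := Subsingleton.elim _ _
  map₂_whisker_left _ _ _ _ := Subsingleton.elim _ _
  map₂_whisker_right _ _ := Subsingleton.elim _ _
  map₂_associator _ _ _ := Subsingleton.elim _ _
  map₂_left_unitor _ := Subsingleton.elim _ _
  map₂_right_unitor _ := Subsingleton.elim _ _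

end Gamma

/-! ### The slices of `C` indexed by `(∫K)ᵒᵖ`, and their 2-colimit in `Cat` -/

section SliceCocone

variable {C : Type u} [SmallCategory C] [HasPullbacks C]

/-- A pseudococone with top `D` on the pseudofunctor `(∫K)ᵒᵖ ⥤ Cat` which sends `(x, a)` to the
slice `C/x` and `f : (x, a) ⟶ (y, b)` to the pullback functor `f⁻¹ : C/y ⥤ C/x`: it consists of
functors `ψ_(x,a) : C/x ⥤ D` and natural isomorphisms `θ_f : ψ_(y,b) ≅ f⁻¹ ⋙ ψ_(x,a)`,
compatible with composition, i.e. with the canonical isomorphisms `(f ≫ g)⁻¹ ≅ g⁻¹ ⋙ f⁻¹`.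
(Since the `θ_f` are invertible, compatibility with identities is a consequence.) -/
structure SliceCocone (K : C ⥤ Type u) (D : Type u) [SmallCategory D] : Type u where
  leg (p : K.Elements) : Over p.1 ⥤ D
  glue {p q : K.Elements} (f : p ⟶ q) : leg q ≅ Over.pullback f.1 ⋙ leg p
  glue_comp {p q r : K.Elements} (f : p ⟶ q) (g : q ⟶ r) :
    (glue (f ≫ g)).hom =
      (glue g).hom ≫ Functor.whiskerLeft (Over.pullback g.1) (glue f).hom ≫
        (Functor.associator (Over.pullback g.1) (Over.pullback f.1) (leg p)).inv ≫
          Functor.whiskerRight (Over.pullbackComp f.1 g.1).inv (leg p)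

namespace SliceCocone

variable {K K' : C ⥤ Type u} {D E : Type u} [SmallCategory D] [SmallCategory E]

/-- A modification between pseudococones. -/
@[ext]
structure Hom (ψ ψ' : SliceCocone K D) : Type u where
  app (p : K.Elements) : ψ.leg p ⟶ ψ'.leg p
  comm {p q : K.Elements} (f : p ⟶ q) :
    (ψ.glue f).hom ≫ Functor.whiskerLeft (Over.pullback f.1) (app p) =
      app q ≫ (ψ'.glue f).hom

instance : Category (SliceCocone K D) where
  Hom := Hom
  id ψ := ⟨fun _ ↦ 𝟙 _, by intros; simp⟩
  comp ρ σ := ⟨fun p ↦ ρ.app p ≫ σ.app p, by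
    intro p q f
    rw [Functor.whiskerLeft_comp, ← Category.assoc, ρ.comm, Category.assoc, σ.comm,
      Category.assoc]⟩

@[ext]
lemma hom_ext {ψ ψ' : SliceCocone K D} {ρ σ : ψ ⟶ ψ'} (h : ∀ p, ρ.app p = σ.app p) : ρ = σ :=
  Hom.ext (funext h)

@[simp] lemma id_app (ψ : SliceCocone K D) (p : K.Elements) : Hom.app (𝟙 ψ) p = 𝟙 _ := rfl

@[simp] lemma comp_app {ψ ψ' ψ'' : SliceCocone K D} (ρ : ψ ⟶ ψ') (σ : ψ' ⟶ ψ'')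
    (p : K.Elements) : (ρ ≫ σ).app p = ρ.app p ≫ σ.app p := rfl

/-- The pseudococone with top `E` obtained by composing with a functor `D ⥤ E`. -/
@[simps]
def postcomp (ψ : SliceCocone K D) (P : D ⥤ E) : SliceCocone K E where
  leg p := ψ.leg p ⋙ P
  glue {p q} f := Functor.isoWhiskerRight (ψ.glue f) P ≪≫ Functor.associator _ _ _
  glue_comp f g := by
    ext x
    have h := congrArg P.map (NatTrans.congr_app (ψ.glue_comp f g) x)
    simpa using h

/-- Composition with a pseudococone `ψ` with top `D`, as a functor
`Cat(D, E) ⥤ Cocone(E)`. -/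
@[simps]
def precompose (ψ : SliceCocone K D) (E : Type u) [SmallCategory E] :
    (D ⥤ E) ⥤ SliceCocone K E where
  obj P := ψ.postcomp P
  map τ := ⟨fun p ↦ Functor.whiskerLeft (ψ.leg p) τ, fun {p q} f ↦ by
    ext x
    change (_ ≫ 𝟙 _) ≫ τ.app _ = τ.app _ ≫ _ ≫ 𝟙 _
    rw [Category.comp_id, Category.comp_id]
    exact τ.naturality ((ψ.glue f).hom.app x)⟩
  map_id _ := rfl
  map_comp _ _ := rfl

/-- `ψ` exhibits `D` as the 2-colimit in `Cat` of the slices `C/x`, indexed by `(∫K)ᵒᵖ`. -/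
def IsTwoColimit (ψ : SliceCocone K D) : Prop :=
  ∀ (E : Type u) [SmallCategory E], (ψ.precompose E).IsEquivalence

/-- The restriction of a pseudococone on `(∫K')ᵒᵖ` along `α : K ⟶ K'`; its component at `(x, a)`
is the component at `(x, α_x a)`. -/
@[simps]
def restrict (α : K ⟶ K') (ψ : SliceCocone K' D) : SliceCocone K D where
  leg p := ψ.leg ((CategoryOfElements.map α).obj p)
  glue f := ψ.glue ((CategoryOfElements.map α).map f)
  glue_comp f g := by
    have h := ψ.glue_comp ((CategoryOfElements.map α).map f) ((CategoryOfElements.map α).map g)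
    exact h

end SliceCocone

end SliceCocone

/-! ### The construction `K ↦ (φ_K : C ⥤ C_K)` -/

section Construction

variable {κ : Cardinal.{u}} [Fact κ.IsRegular] {C : LexCat κ}

/-- The canonical equivalence from `C` to its slice `C/1` over the terminal object. -/
def toSliceTerminal (C : LexCat κ) : C ⥤ Over (⊤_ (C : Type u)) :=
  (Over.equivalenceOfIsTerminal (terminalIsTerminal (C := (C : Type u)))).inverse

/-- The data exhibiting a pseudofunctor `L : Lex_κ(C, Set) ⥤ C ↓ Lex_κ^∼` as the functor
`K ↦ (φ_K : C ⥤ C_K)`, where `C_K` is the 2-colimit of the slices `C/x` over `(∫K)ᵒᵖ`. -/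
structure SliceColimitData (L : LocallyDiscrete (LexFun κ C) ⥤ᵖ Coslice C) where
  /-- The pseudococone `(φ_K^(x,a) : C/x ⥤ C_K)`. -/
  cocone (K : LexFun κ C) : SliceCocone K.obj (L.obj ⟨K⟩).cod
  /-- `C_K` is the 2-colimit of the slices. -/
  isTwoColimit (K : LexFun κ C) : (cocone K).IsTwoColimit
  /-- `φ_K : C ⥤ C_K` is the leg at `(1, *)`, where `*` is the element of `K(1)`. -/
  baseIso (K : LexFun κ C) (t : K.obj.obj (⊤_ (C : Type u))) :
    (L.obj ⟨K⟩).functor ≅ toSliceTerminal C ⋙ (cocone K).leg ⟨⊤_ (C : Type u), t⟩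
  /-- For `α : K ⟶ K'` the functor `C_α : C_K ⥤ C_K'` is the one induced by the pseudococone
  `(φ_K'^(x, α_x a))` on the slices indexed by `(∫K)ᵒᵖ`. -/
  mapIso {K K' : LexFun κ C} (α : K ⟶ K') :
    (cocone K).postcomp (L.map α.toLoc).functor ≅ (cocone K').restrict α.hom
  /-- The isomorphism `φ_K ⋙ C_α ≅ φ_K'` is the component at `(1, *)` of `mapIso`. -/
  mapIso_base {K K' : LexFun κ C} (α : K ⟶ K') (t : K.obj.obj (⊤_ (C : Type u))) :
    (L.map α.toLoc).ν.hom ≫ (baseIso K' (α.hom.app _ t)).hom =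
      Functor.whiskerRight (baseIso K t).hom (L.map α.toLoc).functor ≫
        (Functor.associator _ _ _).hom ≫
          Functor.whiskerLeft (toSliceTerminal C) ((mapIso α).hom.app ⟨⊤_ (C : Type u), t⟩)

end Construction

/-! ### (2,1)-adjunctions with a 1-category -/

section Adjunction

variable {A : Type u₁} [Category.{v₁} A] {B : Type u₂} [Bicategory.{w, v₂} B]

/-- A (2,1)-adjunction `L ⊣ R` between a 1-category `A` and a bicategory `B`: equivalences of
hom-categories `B(L K, M) ≌ A(K, R M)` natural in `K` and in `M`. As `A(K, R M)` is a discrete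
category, the naturality squares are equalities and there are no further coherence conditions. -/
structure TwoOneAdjunction (L : LocallyDiscrete A ⥤ᵖ B) (R : B ⥤ᵖ LocallyDiscrete A) where
  homEquiv (K : LocallyDiscrete A) (M : B) : (L.obj K ⟶ M) ≌ (K ⟶ R.obj M)
  naturality_left {K K' : LocallyDiscrete A} {M : B} (α : K' ⟶ K) (F : L.obj K ⟶ M) :
    (homEquiv K' M).functor.obj (L.map α ≫ F) = α ≫ (homEquiv K M).functor.obj F
  naturality_right {K : LocallyDiscrete A} {M N : B} (F : L.obj K ⟶ M) (H : M ⟶ N) :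
    (homEquiv K N).functor.obj (F ≫ H) = (homEquiv K M).functor.obj F ≫ R.map H

/-- The unit `K ⟶ R (L K)` of the adjunction. -/
def TwoOneAdjunction.unit {L : LocallyDiscrete A ⥤ᵖ B} {R : B ⥤ᵖ LocallyDiscrete A}
    (adj : TwoOneAdjunction L R) (K : A) : K ⟶ (R.obj (L.obj ⟨K⟩)).as :=
  ((adj.homEquiv ⟨K⟩ (L.obj ⟨K⟩)).functor.obj (𝟙 _)).as

/-- The composite of pseudofunctors `A ⥤ B ⥤ A`, as a functor between 1-categories. -/
def compFunctor (L : LocallyDiscrete A ⥤ᵖ B) (R : B ⥤ᵖ LocallyDiscrete A) : A ⥤ A where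
  obj K := (R.obj (L.obj ⟨K⟩)).as
  map α := (R.map (L.map α.toLoc)).as
  map_id K := congrArg Discrete.as
    (LocallyDiscrete.eq_of_hom ((L.comp R).mapId ⟨K⟩).hom)
  map_comp α β := congrArg Discrete.as
    (LocallyDiscrete.eq_of_hom ((L.comp R).mapComp α.toLoc β.toLoc).hom)

end Adjunction

end Diagrams

end

/-!
# The category `C_K` and the coreflection of `Lex_κ(C, Set)` in `C ↓ Lex_κ^∼`

Let `R : ∫K ⥤ C` be the projection from the category of elements. The comma category
`Comma (𝟭 C) R` has the pairs `(s : e ⟶ x, a ∈ K x)` as its objects: it is the total category of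
the slices `C/x`, and its cartesian morphisms are those whose underlying square in `C` is a
pullback. Inverting them turns the pullback functors into glueing isomorphisms, so that functors
out of the localization `C_K` are the same as pseudococones on the slices
(`isTwoColimit_colimitCocone`).

The total category is `κ`-lex, because `C` and `∫K` are. The cartesian morphisms have a calculus of
right fractions, and fewer than `κ` of them with the same target have a common refinement. Hence
`κ`-small products and equalizers of diagrams in `C_K` may be computed in the total category, and
`C_K` and the localization functor are `κ`-lex (`isLexCategory_of_isLocalization`,
`isLexFunctor_of_isLocalization`).

The functor `φ_K` sends `e` to `(e ⟶ 1, *)`. In `C_K` the objects `(𝟙 x, a)` become terminal, so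
that each `a ∈ K x` gives a global element of `φ_K x`, the image of `(𝟙 x, a) ⟶ (x ⟶ 1, *)`; by the
calculus of fractions every global element arises from exactly one `a`. This is the unit
`K ≅ Γ φ_K` (`unitMap`). Moreover `(s : e ⟶ x, a)` is the pullback of `φ_K s : φ_K e ⟶ φ_K x` along
the global element `a` (`isPullback_totalSlice`). So a 1-cell `φ_K ⟶ N` must send it to the pullback
of `N s` along the global element of `N x` which the transpose `K ⟶ Γ N` assigns to `a`. This
formula defines a 1-cell for each `K ⟶ Γ N` (`extend`), any two 1-cells with the same transpose are
isomorphic (`nonempty_iso_of_gammaMap_eq`), and a 2-cell out of `φ_K` is unique, as a map into a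
pullback is determined by its projections. The adjunction follows, and the uniqueness of 2-cells
makes all coherence conditions of the pseudofunctor `K ↦ φ_K` automatic.
-/

noncomputable section

namespace Diagrams

/-! ### `κ`-lex categories and functors via products and equalizers -/

section LexCriteria

variable {κ : Cardinal.{w}} {C : Type u₁} [Category.{v₁} C] {D : Type u₂} [Category.{v₂} D]

lemma IsLexCategory.hasProductsOfShape (hC : IsLexCategory κ C) {ι : Type w}
    (hι : HasCardinalLT ι κ) : HasLimitsOfShape (Discrete ι) C :=
  hC _ ((hasCardinalLT_arrow_discrete_iff κ).2 hι)

lemma IsLexFunctor.preservesProductsOfShape {F : C ⥤ D} (hF : IsLexFunctor κ F) {ι : Type w}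
    (hι : HasCardinalLT ι κ) : PreservesLimitsOfShape (Discrete ι) F :=
  hF _ ((hasCardinalLT_arrow_discrete_iff κ).2 hι)

lemma IsLexFunctor.preservesFiniteLimits [Fact κ.IsRegular] {F : C ⥤ D}
    (hF : IsLexFunctor κ F) : PreservesFiniteLimits F :=
  preservesFiniteLimits_of_preservesFiniteLimitsOfSize.{w} F
    (fun J _ _ ↦ hF J (hasCardinalLT_arrow_of_fin J))

lemma IsLexFunctor.of_iso {F G : C ⥤ D} (hF : IsLexFunctor κ F) (e : F ≅ G) :
    IsLexFunctor κ G := fun J _ hJ ↦ by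
  have := hF J hJ
  exact preservesLimitsOfShape_of_natIso e

lemma hasCardinalLT_sigma_hom {J : Type w} [SmallCategory J] (hJ : HasCardinalLT (Arrow J) κ) :
    HasCardinalLT (Σ p : J × J, p.1 ⟶ p.2) κ :=
  hJ.of_injective (fun f ↦ Arrow.mk f.2) (by
    rintro ⟨⟨_, _⟩, f⟩ ⟨⟨_, _⟩, g⟩ h
    obtain rfl := congrArg Comma.left h
    obtain rfl := congrArg Comma.right h
    obtain rfl := Arrow.mk_injective _ _ h
    rfl)

lemma IsLexCategory.of_products_of_equalizers
    (h : ∀ ι : Type w, HasCardinalLT ι κ → HasLimitsOfShape (Discrete ι) C) [HasEqualizers C] :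
    IsLexCategory κ C := fun J _ hJ ↦ by
  have := h J (hasCardinalLT_of_hasCardinalLT_arrow hJ)
  have := h _ (hasCardinalLT_sigma_hom hJ)
  exact ⟨fun F ↦ hasLimit_of_equalizer_and_product F⟩

lemma IsLexFunctor.of_products_of_equalizers (hC : IsLexCategory κ C) [HasEqualizers C]
    (F : C ⥤ D) (h : ∀ ι : Type w, HasCardinalLT ι κ → PreservesLimitsOfShape (Discrete ι) F)
    [PreservesLimitsOfShape WalkingParallelPair F] : IsLexFunctor κ F := fun J _ hJ ↦ by
  have hJ₁ := hasCardinalLT_of_hasCardinalLT_arrow hJ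
  have hJ₂ := hasCardinalLT_sigma_hom hJ
  have := hC.hasProductsOfShape hJ₁
  have := hC.hasProductsOfShape hJ₂
  have := h _ hJ₁
  have := h _ hJ₂
  exact preservesLimit_of_preservesEqualizers_and_product F

end LexCriteria

/-! ### Localizations with a `κ`-ary right calculus of fractions -/

section Localization

variable {κ : Cardinal.{w}} {G : Type u₁} [Category.{v₁} G] {D : Type u₂} [Category.{v₂} D]
  {E : Type u₃} [Category.{v₃} E] {J : Type*} [Category* J]

/-- If a functor `L : G ⥤ D` preserves limits of shape `J`, and diagrams of shape `J` in `D` lift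
to `G` up to isomorphism, then `D` inherits the limits of shape `J` from `G`. -/
lemma hasLimitsOfShape_of_lift (L : G ⥤ D) [HasLimitsOfShape J G] [PreservesLimitsOfShape J L]
    (hl : ∀ F : J ⥤ D, ∃ F' : J ⥤ G, Nonempty (F' ⋙ L ≅ F)) : HasLimitsOfShape J D :=
  ⟨fun F ↦ by
    obtain ⟨F', ⟨e⟩⟩ := hl F
    exact hasLimit_of_iso e⟩

/-- If diagrams of shape `J` in `D` lift along `L : G ⥤ D` up to isomorphism, preservation of
limits of shape `J` by a functor out of `D` can be tested on `G`. -/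
lemma preservesLimitsOfShape_of_lift (L : G ⥤ D) [HasLimitsOfShape J G]
    [PreservesLimitsOfShape J L] (hl : ∀ F : J ⥤ D, ∃ F' : J ⥤ G, Nonempty (F' ⋙ L ≅ F))
    (H : D ⥤ E) [PreservesLimitsOfShape J (L ⋙ H)] : PreservesLimitsOfShape J H :=
  ⟨fun {F} ↦ by
    obtain ⟨F', ⟨e⟩⟩ := hl F
    have : PreservesLimit (F' ⋙ L) H :=
      preservesLimit_of_preserves_limit_cone (isLimitOfPreserves L (limit.isLimit F'))
        (isLimitOfPreserves (L ⋙ H) (limit.isLimit F'))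
    exact preservesLimit_of_iso_diagram H e⟩

/-- Being a limit cone can be tested on the objects in the image of an essentially surjective
functor. -/
def isLimitOfEssSurj (L : G ⥤ D) [L.EssSurj] {F : J ⥤ D} (c : Cone F)
    (h : ∀ (T : G) (τ : (Functor.const J).obj (L.obj T) ⟶ F),
      ∃! φ : L.obj T ⟶ c.pt, ∀ j, φ ≫ c.π.app j = τ.app j) : IsLimit c :=
  IsLimit.ofExistsUnique fun s ↦ by
    let e := L.objObjPreimageIso s.pt
    obtain ⟨φ, hφ, hφ'⟩ := h (L.objPreimage s.pt) ((Functor.const J).map e.hom ≫ s.π)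
    refine ⟨e.inv ≫ φ, fun j ↦ by simp [hφ], fun ψ hψ ↦ ?_⟩
    rw [← hφ' (e.hom ≫ ψ) (fun j ↦ by simp [hψ]), e.inv_hom_id_assoc]

lemma exists_fraction (L : G ⥤ D) (W : MorphismProperty G) [L.IsLocalization W]
    [W.HasRightCalculusOfFractions] {X Y : G} (φ : L.obj X ⟶ L.obj Y) :
    ∃ (Z : G) (s : Z ⟶ X) (f : Z ⟶ Y), W s ∧ L.map s ≫ φ = L.map f := by
  obtain ⟨z, rfl⟩ := Localization.exists_rightFraction L W φ
  exact ⟨z.X', z.s, z.f, z.hs, z.map_s_comp_map _ _⟩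

lemma exists_fraction₂ (L : G ⥤ D) (W : MorphismProperty G) [L.IsLocalization W]
    [W.HasRightCalculusOfFractions] {X Y Y' : G} (φ : L.obj X ⟶ L.obj Y) (ψ : L.obj X ⟶ L.obj Y') :
    ∃ (Z : G) (s : Z ⟶ X) (f : Z ⟶ Y) (g : Z ⟶ Y'), W s ∧ L.map s ≫ φ = L.map f ∧
      L.map s ≫ ψ = L.map g := by
  obtain ⟨Z, s, f, hs, hf⟩ := exists_fraction L W φ
  obtain ⟨Z', s', g, hs', hg⟩ := exists_fraction L W (L.map s ≫ ψ)
  exact ⟨Z', s' ≫ s, s' ≫ f, g, W.comp_mem _ _ hs' hs, by simp [hf], by simpa using hg⟩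

/-- A morphism of the localization which equalizes `F.map .left` and `F.map .right` is represented
by a fraction whose numerator equalizes them, after refining the denominator. -/
lemma preservesEqualizers_of_isLocalization (L : G ⥤ D) (W : MorphismProperty G)
    [L.IsLocalization W] [W.HasRightCalculusOfFractions] :
    PreservesLimitsOfShape WalkingParallelPair L := by
  have := Localization.essSurj L W
  have hW := Localization.inverts L W
  refine ⟨fun {F} ↦ ⟨fun {c} hc ↦ ⟨isLimitOfEssSurj L _ fun T τ ↦ ?_⟩⟩⟩
  have hτ {j j' : WalkingParallelPair} (f : j ⟶ j') : τ.app j ≫ L.map (F.map f) = τ.app j' := by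
    simpa using (τ.naturality f).symm
  refine existsUnique_of_exists_of_unique ?_ fun φ ψ hφ hψ ↦ ?_
  · obtain ⟨Z, s, f, hs, hf⟩ := exists_fraction L W (τ.app .zero)
    have := hW s hs
    have h : L.map (f ≫ F.map .left) = L.map (f ≫ F.map .right) := by
      simp only [Functor.map_comp, ← hf, Category.assoc]
      rw [hτ, hτ]
    obtain ⟨Z', t, ht, h⟩ := (MorphismProperty.map_eq_iff_precomp L W _ _).1 h
    have := hW t ht
    let d : Cone F :=
      { pt := Z'
        π :=
          { app := fun j ↦ match j with
              | .zero => t ≫ f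
              | .one => t ≫ f ≫ F.map .left
            naturality := by
              rintro _ _ (_ | _ | _)
              · simp
              · simpa using h
              · simp } }
    refine ⟨inv (L.map s) ≫ inv (L.map t) ≫ L.map (hc.lift d), fun j ↦ ?_⟩
    rw [Category.assoc, IsIso.inv_comp_eq, Category.assoc, IsIso.inv_comp_eq]
    change L.map (hc.lift d) ≫ L.map (c.π.app j) = _
    rw [← L.map_comp, hc.fac]
    cases j
    · simp [d, hf]
    · simp [d, ← hf, hτ]
  · obtain ⟨Z, s, f, g, hs, hf, hg⟩ := exists_fraction₂ L W φ ψ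
    have := hW s hs
    have h : L.map (f ≫ c.π.app .zero) = L.map (g ≫ c.π.app .zero) := by
      rw [L.map_comp, L.map_comp, ← hf, ← hg, Category.assoc, Category.assoc]
      exact congrArg _ ((hφ .zero).trans (hψ .zero).symm)
    obtain ⟨Z', t, ht, h⟩ := (MorphismProperty.map_eq_iff_precomp L W _ _).1 h
    have := hW t ht
    have : t ≫ f = t ≫ g := hc.hom_ext fun j ↦ by
      cases j
      · simpa using h
      · rw [← c.w .left, Category.assoc, Category.assoc, reassoc_of% h]
    rw [← cancel_epi (L.map s), hf, hg, ← cancel_epi (L.map t), ← L.map_comp, this, L.map_comp]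

/-- A `κ`-ary Ore condition: every `κ`-small family of maps in `W` with a common target is
refined by a single map in `W`. -/
def HasCommonRefinements (κ : Cardinal.{w}) (W : MorphismProperty G) : Prop :=
  ∀ (ι : Type w), HasCardinalLT ι κ → ∀ (T : G) (T' : ι → G) (s : ∀ j, T' j ⟶ T),
    (∀ j, W (s j)) → ∃ (Z : G) (t : Z ⟶ T) (h : ∀ j, Z ⟶ T' j), W t ∧ ∀ j, h j ≫ s j = t

/-- A `κ`-small family of fractions with the same source can be brought to a common denominator,
and fewer than `κ` equalities in the localization hold after a single refinement. -/
lemma preservesProducts_of_isLocalization (L : G ⥤ D) {W : MorphismProperty G} [L.IsLocalization W]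
    [W.HasRightCalculusOfFractions] (hr : HasCommonRefinements κ W) {ι : Type w}
    (hι : HasCardinalLT ι κ) : PreservesLimitsOfShape (Discrete ι) L := by
  have := Localization.essSurj L W
  have hW := Localization.inverts L W
  refine ⟨fun {F} ↦ ⟨fun {c} hc ↦ ⟨isLimitOfEssSurj L _ fun T τ ↦ ?_⟩⟩⟩
  refine existsUnique_of_exists_of_unique ?_ fun φ ψ hφ hψ ↦ ?_
  · choose Z s f hs hf using fun j : ι ↦ exists_fraction L W (τ.app ⟨j⟩)
    obtain ⟨T', t, h, ht, hh⟩ := hr ι hι T Z s hs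
    have := hW t ht
    let d : Cone F :=
      { pt := T'
        π := Discrete.natTrans fun j ↦ h j.as ≫ f j.as }
    refine ⟨inv (L.map t) ≫ L.map (hc.lift d), fun ⟨j⟩ ↦ ?_⟩
    rw [Category.assoc, IsIso.inv_comp_eq]
    change L.map (hc.lift d) ≫ L.map (c.π.app ⟨j⟩) = _
    rw [← L.map_comp, hc.fac, ← hh j, L.map_comp, Category.assoc, hf, ← L.map_comp]
    rfl
  · obtain ⟨Z, s, f, g, hs, hf, hg⟩ := exists_fraction₂ L W φ ψ
    have := hW s hs
    have h (j : ι) : L.map (f ≫ c.π.app ⟨j⟩) = L.map (g ≫ c.π.app ⟨j⟩) := by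
      rw [L.map_comp, L.map_comp, ← hf, ← hg, Category.assoc, Category.assoc]
      exact congrArg _ ((hφ ⟨j⟩).trans (hψ ⟨j⟩).symm)
    choose Z' t ht h using fun j ↦ (MorphismProperty.map_eq_iff_precomp L W _ _).1 (h j)
    obtain ⟨T', t', k, ht', hk⟩ := hr ι hι Z Z' t ht
    have := hW t' ht'
    have : t' ≫ f = t' ≫ g := hc.hom_ext fun ⟨j⟩ ↦ by
      rw [← hk j]
      simp only [Category.assoc, h]
    rw [← cancel_epi (L.map s), hf, hg, ← cancel_epi (L.map t'), ← L.map_comp, this, L.map_comp]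

lemma exists_lift_discrete (L : G ⥤ D) (W : MorphismProperty G) [L.IsLocalization W]
    {ι : Type w} (F : Discrete ι ⥤ D) : ∃ F' : Discrete ι ⥤ G, Nonempty (F' ⋙ L ≅ F) := by
  have := Localization.essSurj L W
  exact ⟨Discrete.functor fun j ↦ L.objPreimage (F.obj ⟨j⟩),
    ⟨Discrete.natIso fun j ↦ L.objObjPreimageIso (F.obj j)⟩⟩

lemma exists_lift_parallelPair (L : G ⥤ D) (W : MorphismProperty G) [L.IsLocalization W]
    [W.HasRightCalculusOfFractions] (F : WalkingParallelPair ⥤ D) :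
    ∃ F' : WalkingParallelPair ⥤ G, Nonempty (F' ⋙ L ≅ F) := by
  have := Localization.essSurj L W
  have hW := Localization.inverts L W
  let e (j) := L.objObjPreimageIso (F.obj j)
  obtain ⟨Z, s, f, g, hs, hf, hg⟩ := exists_fraction₂ L W
    ((e .zero).hom ≫ F.map .left ≫ (e .one).inv) ((e .zero).hom ≫ F.map .right ≫ (e .one).inv)
  have := hW s hs
  refine ⟨parallelPair f g, ⟨parallelPair.ext (asIso (L.map s) ≪≫ e .zero) (e .one) ?_ ?_⟩⟩
  · change L.map f ≫ (e .one).hom = (L.map s ≫ (e .zero).hom) ≫ F.map .left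
    simp [← hf]
  · change L.map g ≫ (e .one).hom = (L.map s ≫ (e .zero).hom) ≫ F.map .right
    simp [← hg]

theorem isLexFunctor_of_isLocalization (L : G ⥤ D) {W : MorphismProperty G}
    [L.IsLocalization W] [W.HasRightCalculusOfFractions] [Fact κ.IsRegular] (hG : IsLexCategory κ G)
    (hr : HasCommonRefinements κ W) : IsLexFunctor κ L := by
  have := hG.hasFiniteLimits
  have := preservesEqualizers_of_isLocalization L W
  exact .of_products_of_equalizers hG L fun ι hι ↦ preservesProducts_of_isLocalization L hr hι

theorem isLexCategory_of_isLocalization (L : G ⥤ D) {W : MorphismProperty G}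
    [L.IsLocalization W] [W.HasRightCalculusOfFractions] [Fact κ.IsRegular] (hG : IsLexCategory κ G)
    (hr : HasCommonRefinements κ W) : IsLexCategory κ D := by
  have := hG.hasFiniteLimits
  have := preservesEqualizers_of_isLocalization L W
  have : HasEqualizers D := hasLimitsOfShape_of_lift L (exists_lift_parallelPair L W)
  refine .of_products_of_equalizers fun ι hι ↦ ?_
  have := hG.hasProductsOfShape hι
  have := preservesProducts_of_isLocalization L hr hι
  exact hasLimitsOfShape_of_lift L (exists_lift_discrete L W)

/-- A functor out of a localization is `κ`-lex as soon as its restriction is. -/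
theorem isLexFunctor_of_comp_isLocalization (L : G ⥤ D) {W : MorphismProperty G}
    [L.IsLocalization W] [W.HasRightCalculusOfFractions] [Fact κ.IsRegular] (hG : IsLexCategory κ G)
    (hr : HasCommonRefinements κ W) {H : D ⥤ E} (hH : IsLexFunctor κ (L ⋙ H)) :
    IsLexFunctor κ H := by
  have := hG.hasFiniteLimits
  have := preservesEqualizers_of_isLocalization L W
  have hD : IsLexCategory κ D := isLexCategory_of_isLocalization L hG hr
  have := hD.hasFiniteLimits
  have := hH.preservesFiniteLimits
  have : PreservesLimitsOfShape WalkingParallelPair H :=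
    preservesLimitsOfShape_of_lift L (exists_lift_parallelPair L W) H
  refine .of_products_of_equalizers hD H fun ι hι ↦ ?_
  have := hG.hasProductsOfShape hι
  have := hH.preservesProductsOfShape hι
  have := preservesProducts_of_isLocalization L hr hι
  exact preservesLimitsOfShape_of_lift L (exists_lift_discrete L W) H

end Localization

/-! ### Cartesian squares in a comma category `C ↓ R` -/

section CartesianSquares

variable {κ : Cardinal.{w}} {C : Type u₁} [Category.{v₁} C] {B : Type u₂} [Category.{v₂} B]
  {R : B ⥤ C}

variable (R) in
/-- The category `C ↓ R` is the total category of the slices `C/R b` for `b : B`; its cartesian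
morphisms for the projection to `B` are the squares which are pullbacks. -/
def cartesianSquares : MorphismProperty (Comma (𝟭 C) R) :=
  fun X Y f ↦ IsPullback f.left X.hom Y.hom (R.map f.right)

instance : (cartesianSquares R).IsMultiplicative where
  id_mem X := by
    have : IsPullback (𝟙 X.left) X.hom X.hom (𝟙 (R.obj X.right)) := IsPullback.id_horiz _
    simpa [cartesianSquares] using this
  comp_mem f g hf hg := by
    have := IsPullback.paste_horiz hf hg
    simpa [cartesianSquares] using this

lemma cartesianSquares.exists_lift {T X Y : Comma (𝟭 C) R} {f : X ⟶ Y}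
    (hf : cartesianSquares R f) (g : T ⟶ Y) (v : T.right ⟶ X.right) (hv : v ≫ f.right = g.right) :
    ∃ h : T ⟶ X, h.right = v ∧ h ≫ f = g := by
  obtain ⟨l, hl₁, hl₂⟩ := IsPullback.exists_lift hf g.left (T.hom ≫ R.map v)
    (by rw [Category.assoc, ← R.map_comp, hv]; exact g.w)
  exact ⟨⟨l, v, hl₂⟩, rfl, by ext <;> simp [hl₁, hv]⟩

lemma cartesianSquares.hom_ext {T X Y : Comma (𝟭 C) R} {f : X ⟶ Y}
    (hf : cartesianSquares R f) {h h' : T ⟶ X} (hr : h.right = h'.right)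
    (hl : h ≫ f = h' ≫ f) : h = h' := by
  ext
  · refine IsPullback.hom_ext hf (congrArg CommaMorphism.left hl) ?_
    exact h.w.trans ((by rw [hr] : T.hom ≫ R.map h.right = T.hom ≫ R.map h'.right).trans h'.w.symm)
  · exact hr

section

variable [HasPullbacks C]

/-- The source of the cartesian lift of `u : b ⟶ Y.right` at `Y`. -/
abbrev cartesianLift (Y : Comma (𝟭 C) R) {b : B} (u : b ⟶ Y.right) : Comma (𝟭 C) R where
  left := pullback Y.hom (R.map u)
  right := b
  hom := pullback.snd _ _

/-- The cartesian lift of `u : b ⟶ Y.right` at `Y`. -/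
abbrev cartesianLiftHom (Y : Comma (𝟭 C) R) {b : B} (u : b ⟶ Y.right) : cartesianLift Y u ⟶ Y where
  left := pullback.fst _ _
  right := u
  w := pullback.condition

lemma cartesianLiftHom_mem (Y : Comma (𝟭 C) R) {b : B} (u : b ⟶ Y.right) :
    cartesianSquares R (cartesianLiftHom Y u) :=
  IsPullback.of_hasPullback _ _

instance [HasPullbacks B] [HasEqualizers B] :
    (cartesianSquares R).HasRightCalculusOfFractions where
  exists_rightFraction X Y φ := by
    obtain ⟨h, -, hh⟩ := cartesianSquares.exists_lift φ.hs
      (cartesianLiftHom X (pullback.fst φ.f.right φ.s.right) ≫ φ.f)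
      (pullback.snd φ.f.right φ.s.right) pullback.condition.symm
    exact ⟨⟨_, cartesianLiftHom_mem X (pullback.fst φ.f.right φ.s.right), h⟩, hh.symm⟩
  ext X Y Y' f₁ f₂ s hs h := by
    refine ⟨_, _, cartesianLiftHom_mem X (equalizer.ι f₁.right f₂.right), hs.hom_ext ?_ ?_⟩
    · exact equalizer.condition _ _
    · simp [h]

/-- Common refinements of a family of cartesian maps over `u j : b j ⟶ b` are obtained from a cone
on the family `u`; here it is constructed from products and equalizers in `B`. -/
lemma hasCommonRefinements_cartesianSquares [Fact κ.IsRegular] (hB : IsLexCategory κ B) :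
    HasCommonRefinements κ (cartesianSquares R) := fun ι hι T T' s hs ↦ by
  have := hB.hasFiniteLimits
  have := hB.hasProductsOfShape hι
  let P := ∏ᶜ fun j ↦ (T' j).right
  let a : T.right ⨯ P ⟶ ∏ᶜ fun _ : ι ↦ T.right := Pi.lift fun _ ↦ prod.fst
  let b : T.right ⨯ P ⟶ ∏ᶜ fun _ : ι ↦ T.right := Pi.lift fun j ↦ prod.snd ≫ Pi.π _ j ≫ (s j).right
  let u := equalizer.ι a b ≫ prod.fst
  have hu (j : ι) : (equalizer.ι a b ≫ prod.snd ≫ Pi.π _ j) ≫ (s j).right = u := by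
    have := equalizer.condition a b =≫ Pi.π _ j
    simpa [a, b] using this.symm
  choose h _ hh using fun j ↦ (hs j).exists_lift (cartesianLiftHom T u) _ (hu j)
  exact ⟨_, cartesianLiftHom T u, h, cartesianLiftHom_mem T u, hh⟩

end

section

lemma IsLexCategory.comma (hC : IsLexCategory κ C) (hB : IsLexCategory κ B)
    (hR : IsLexFunctor κ R) : IsLexCategory κ (Comma (𝟭 C) R) := fun J _ hJ ↦ by
  have := hC J hJ
  have := hB J hJ
  have := hR J hJ
  infer_instance

lemma IsLexFunctor.comma_fst (hC : IsLexCategory κ C) (hB : IsLexCategory κ B)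
    (hR : IsLexFunctor κ R) : IsLexFunctor κ (Comma.fst (𝟭 C) R) := fun J _ hJ ↦ by
  have := hC J hJ
  have := hB J hJ
  have := hR J hJ
  exact ⟨fun {F} ↦ preservesLimit_of_preserves_limit_cone
    (Comma.coneOfPreservesIsLimit F (limit.isLimit _) (limit.isLimit _)) (limit.isLimit _)⟩

lemma IsLexFunctor.comma_snd (hC : IsLexCategory κ C) (hB : IsLexCategory κ B)
    (hR : IsLexFunctor κ R) : IsLexFunctor κ (Comma.snd (𝟭 C) R) := fun J _ hJ ↦ by
  have := hC J hJ
  have := hB J hJ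
  have := hR J hJ
  exact ⟨fun {F} ↦ preservesLimit_of_preserves_limit_cone
    (Comma.coneOfPreservesIsLimit F (limit.isLimit _) (limit.isLimit _)) (limit.isLimit _)⟩

end

end CartesianSquares

/-! ### Categories of elements of `κ`-lex functors -/

section Elements

variable {κ : Cardinal.{u}} {C : Type u} [SmallCategory C] {K : C ⥤ Type u}

lemma IsLexCategory.elements (hC : IsLexCategory κ C) (hK : IsLexFunctor κ K) :
    IsLexCategory κ K.Elements := fun J _ hJ ↦ by
  have := hC J hJ
  have := hK J hJ
  infer_instance

lemma IsLexFunctor.elements_π (hC : IsLexCategory κ C) (hK : IsLexFunctor κ K) :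
    IsLexFunctor κ (CategoryOfElements.π K) := fun J _ hJ ↦ by
  have := hC J hJ
  have := hK J hJ
  infer_instance

end Elements

/-! ### Functors out of the total category of the slices -/

section Total

variable {C : Type u} [Category.{v₁} C] [HasPullbacks C] {B : Type u₂} [Category.{v₂} B]
  {R : B ⥤ C} {E : Type u₁} [Category.{v₃} E]

variable (R) in
/-- The inclusion of the slice `C/R p` as the fibre of `C ↓ R` over `p`. -/
abbrev fibre (p : B) : Over (R.obj p) ⥤ Comma (𝟭 C) R where
  obj s := ⟨s.left, p, s.hom⟩
  map k := ⟨k.left, 𝟙 p, by simp⟩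
  map_comp _ _ := by ext <;> simp

variable (R) in
/-- The cartesian morphisms from `f⁻¹ s` to `s`. -/
def fibreGlue {p q : B} (f : p ⟶ q) : Over.pullback (R.map f) ⋙ fibre R p ⟶ fibre R q where
  app s := cartesianLiftHom ((fibre R q).obj s) f
  naturality s t k := by
    ext
    · exact pullback.lift_fst _ _ _
    · exact (Category.id_comp f).trans (Category.comp_id f).symm

lemma fibreGlue_mem {p q : B} (f : p ⟶ q) (s : Over (R.obj q)) :
    cartesianSquares R ((fibreGlue R f).app s) :=
  cartesianLiftHom_mem ((fibre R q).obj s) f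

/-- The vertical part of a morphism of the total category. -/
def vertical {X Y : Comma (𝟭 C) R} (f : X ⟶ Y) :
    Over.mk X.hom ⟶ (Over.pullback (R.map f.right)).obj (Over.mk Y.hom) :=
  Over.homMk (pullback.lift f.left X.hom f.w) (pullback.lift_snd _ _ _)

lemma vertical_left_fst {X Y : Comma (𝟭 C) R} (f : X ⟶ Y) :
    (vertical f).left ≫ pullback.fst Y.hom (R.map f.right) = f.left :=
  pullback.lift_fst _ _ _

lemma hom_pullback_ext {X Y : C} {f : X ⟶ Y} {s : Over Y} {t : Over X}
    {k k' : t ⟶ (Over.pullback f).obj s}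
    (h : k.left ≫ pullback.fst s.hom f = k'.left ≫ pullback.fst s.hom f) : k = k' := by
  ext
  exact pullback.hom_ext h ((Over.w k).trans (Over.w k').symm)

lemma fibre_map_vertical {X Y : Comma (𝟭 C) R} (f : X ⟶ Y) :
    (fibre R X.right).map (vertical f) ≫ (fibreGlue R f.right).app (Over.mk Y.hom) = f := by
  ext
  · exact vertical_left_fst f
  · exact Category.id_comp _

lemma isIso_vertical {X Y : Comma (𝟭 C) R} (f : X ⟶ Y) (hf : cartesianSquares R f) :
    IsIso (vertical f) := by
  have hf' : IsPullback f.left X.hom Y.hom (R.map f.right) := hf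
  have : IsIso ((Over.forget _).map (vertical f)) := by
    have h : (Over.forget _).map (vertical f) = hf'.isoPullback.hom :=
      pullback.hom_ext ((pullback.lift_fst _ _ _).trans hf'.isoPullback_hom_fst.symm)
        ((pullback.lift_snd _ _ _).trans hf'.isoPullback_hom_snd.symm)
    rw [h]
    exact Iso.isIso_hom hf'.isoPullback
  exact isIso_of_reflects_iso _ (Over.forget _)

/-- Naturality of a transformation between functors on the total category can be tested on
vertical and on cartesian morphisms. -/
lemma naturality_of_fibre {F F' : Comma (𝟭 C) R ⥤ E} (τ : ∀ X, F.obj X ⟶ F'.obj X)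
    (hv : ∀ (p : B) {s t : Over (R.obj p)} (k : s ⟶ t),
      F.map ((fibre R p).map k) ≫ τ ((fibre R p).obj t) =
        τ ((fibre R p).obj s) ≫ F'.map ((fibre R p).map k))
    (hc : ∀ {p q : B} (f : p ⟶ q) (s : Over (R.obj q)),
      F.map ((fibreGlue R f).app s) ≫ τ ((fibre R q).obj s) =
        τ ((fibre R p).obj ((Over.pullback (R.map f)).obj s)) ≫ F'.map ((fibreGlue R f).app s))
    {X Y : Comma (𝟭 C) R} (f : X ⟶ Y) : F.map f ≫ τ Y = τ X ≫ F'.map f := by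
  have h₁ := hv X.right (vertical f)
  have h₂ := hc f.right (Over.mk Y.hom)
  have hf := fibre_map_vertical f
  rw [← hf, F.map_comp, F'.map_comp, Category.assoc]
  exact (congrArg _ h₂).trans ((Category.assoc _ _ _).symm.trans ((congrArg (· ≫ _) h₁).trans
    (Category.assoc _ _ _)))

/-- Functors on the slices `C/R p` with gluing isomorphisms for the change of base functors, whose
compatibility with composition is phrased in terms of the comparison maps
`f⁻¹ g⁻¹ s ⟶ (f ≫ g)⁻¹ s`. -/
structure FibreCocone (R : B ⥤ C) (E : Type u₁) [Category.{v₃} E] where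
  leg (p : B) : Over (R.obj p) ⥤ E
  glue {p q : B} (f : p ⟶ q) : Over.pullback (R.map f) ⋙ leg p ≅ leg q
  glue_comp {p q r : B} (f : p ⟶ q) (g : q ⟶ r) (s : Over (R.obj r))
    (k : (Over.pullback (R.map f)).obj ((Over.pullback (R.map g)).obj s) ⟶
      (Over.pullback (R.map (f ≫ g))).obj s)
    (hk : k.left ≫ pullback.fst s.hom (R.map (f ≫ g)) =
      pullback.fst (pullback.snd s.hom (R.map g)) (R.map f) ≫ pullback.fst s.hom (R.map g)) :
    (leg p).map k ≫ (glue (f ≫ g)).hom.app s =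
      (glue f).hom.app ((Over.pullback (R.map g)).obj s) ≫ (glue g).hom.app s

namespace FibreCocone

variable (ψ : FibreCocone R E)

/-- The action on morphisms of the functor `descend ψ`. -/
def descendMap {X Y : Comma (𝟭 C) R} (f : X ⟶ Y) :
    (ψ.leg X.right).obj (Over.mk X.hom) ⟶ (ψ.leg Y.right).obj (Over.mk Y.hom) :=
  (ψ.leg X.right).map (vertical f) ≫ (ψ.glue f.right).hom.app (Over.mk Y.hom)

lemma descendMap_comp {X Y Z : Comma (𝟭 C) R} (f : X ⟶ Y) (g : Y ⟶ Z) :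
    ψ.descendMap (f ≫ g) = ψ.descendMap f ≫ ψ.descendMap g := by
  let k : (Over.pullback (R.map f.right)).obj
      ((Over.pullback (R.map g.right)).obj (Over.mk Z.hom)) ⟶
        (Over.pullback (R.map (f.right ≫ g.right))).obj (Over.mk Z.hom) :=
    Over.homMk (pullback.lift (pullback.fst _ _ ≫ pullback.fst _ _) (pullback.snd _ _) (by
      have h : pullback.fst Z.hom (R.map g.right) ≫ Z.hom = _ := pullback.condition
      have h' := pullback.condition (f := pullback.snd Z.hom (R.map g.right)) (g := R.map f.right)
      rw [R.map_comp, Category.assoc]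
      exact (congrArg _ h).trans ((Category.assoc _ _ _).symm.trans
        ((congrArg (· ≫ _) h').trans (Category.assoc _ _ _)))))
      (pullback.lift_snd _ _ _)
  have hk : k.left ≫ pullback.fst Z.hom (R.map (f.right ≫ g.right)) =
      pullback.fst (pullback.snd Z.hom (R.map g.right)) (R.map f.right) ≫
        pullback.fst Z.hom (R.map g.right) := pullback.lift_fst _ _ _
  have h : vertical (f ≫ g) =
      vertical f ≫ (Over.pullback (R.map f.right)).map (vertical g) ≫ k := by
    refine hom_pullback_ext ((vertical_left_fst (f ≫ g)).trans ?_)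
    have h₁ : ((Over.pullback (R.map f.right)).map (vertical g)).left ≫
      pullback.fst (pullback.snd Z.hom (R.map g.right)) (R.map f.right) =
        pullback.fst _ _ ≫ (vertical g).left := pullback.lift_fst _ _ _
    simp only [Over.comp_left, Category.assoc]
    refine Eq.trans ?_ (congrArg (_ ≫ _ ≫ ·) hk.symm)
    rw [reassoc_of% h₁, vertical_left_fst]
    exact ((Category.assoc _ _ _).symm.trans (congrArg (· ≫ g.left) (vertical_left_fst f))).symm
  have hn := (ψ.glue f.right).hom.naturality_assoc (vertical g)
    ((ψ.glue g.right).hom.app (Over.mk Z.hom))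
  have hc := ψ.glue_comp f.right g.right (Over.mk Z.hom) k hk
  unfold descendMap
  rw [h]
  simp only [Functor.map_comp, Category.assoc]
  refine congrArg _ (Eq.trans ?_ hn)
  exact congrArg _ hc

lemma isIso_descendMap {X Y : Comma (𝟭 C) R} (f : X ⟶ Y) (hf : cartesianSquares R f) :
    IsIso (ψ.descendMap f) := by
  have := isIso_vertical f hf
  exact IsIso.comp_isIso (f := (ψ.leg X.right).map (vertical f))
    (h := (ψ.glue f.right).hom.app (Over.mk Y.hom))

/-- The functor on the total category which restricts to the given functors on the fibres. -/
@[simps]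
def descend : Comma (𝟭 C) R ⥤ E where
  obj X := (ψ.leg X.right).obj (Over.mk X.hom)
  map f := ψ.descendMap f
  map_id X := by
    -- `descendMap (𝟙 X)` is idempotent and invertible.
    have h := ψ.descendMap_comp (𝟙 X) (𝟙 X)
    have := ψ.isIso_descendMap (𝟙 X) (MorphismProperty.id_mem _ X)
    rw [Category.comp_id] at h
    rw [← cancel_mono (ψ.descendMap (𝟙 X)), ← h, Category.id_comp]
  map_comp := ψ.descendMap_comp

lemma isInvertedBy_descend : (cartesianSquares R).IsInvertedBy ψ.descend :=
  fun _ _ f hf ↦ ψ.isIso_descendMap f hf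

lemma descend_map_fibre (p : B) {s t : Over (R.obj p)} (k : s ⟶ t) :
    ψ.descend.map ((fibre R p).map k) = (ψ.leg p).map k := by
  have h : vertical ((fibre R p).map k) = k ≫ vertical (𝟙 ((fibre R p).obj t)) :=
    hom_pullback_ext ((vertical_left_fst _).trans (by
      refine Eq.trans ?_ (Category.assoc _ _ _).symm
      exact (Category.comp_id _).symm.trans (congrArg _ (vertical_left_fst (𝟙 _)).symm)))
  have h' := ψ.descend.map_id ((fibre R p).obj t)
  simp only [descend_map, descendMap] at h' ⊢
  rw [h]
  exact (congrArg (· ≫ _) (Functor.map_comp _ _ _)).trans ((Category.assoc _ _ _).trans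
    ((congrArg _ h').trans (Category.comp_id _)))

lemma descend_map_fibreGlue {p q : B} (f : p ⟶ q) (s : Over (R.obj q)) :
    ψ.descend.map ((fibreGlue R f).app s) = (ψ.glue f).hom.app s := by
  have h : vertical ((fibreGlue R f).app s) = 𝟙 _ :=
    hom_pullback_ext ((vertical_left_fst _).trans (Category.id_comp _).symm)
  simp only [descend_map, descendMap]
  rw [h]
  exact (congrArg (· ≫ _) (CategoryTheory.Functor.map_id _ _)).trans (Category.id_comp _)

end FibreCocone

end Total

/-! ### The localization at the cartesian morphisms -/

section TotalLocalization

variable {C : Type u} [Category.{v₁} C] [HasPullbacks C] {B : Type u₂} [Category.{v₂} B]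
  {R : B ⥤ C} {E : Type u₁} [Category.{v₃} E]

lemma fibreGlue_comp {p q r : B} (f : p ⟶ q) (g : q ⟶ r) (s : Over (R.obj r))
    (k : (Over.pullback (R.map f)).obj ((Over.pullback (R.map g)).obj s) ⟶
      (Over.pullback (R.map (f ≫ g))).obj s)
    (hk : k.left ≫ pullback.fst s.hom (R.map (f ≫ g)) =
      pullback.fst (pullback.snd s.hom (R.map g)) (R.map f) ≫ pullback.fst s.hom (R.map g)) :
    (fibre R p).map k ≫ (fibreGlue R (f ≫ g)).app s =
      (fibreGlue R f).app ((Over.pullback (R.map g)).obj s) ≫ (fibreGlue R g).app s := by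
  ext
  · exact hk
  · exact Category.id_comp _

variable (R) in
/-- The isomorphisms `f⁻¹ s ≅ s` in the localization at the cartesian morphisms. -/
def glueIso {p q : B} (f : p ⟶ q) :
    Over.pullback (R.map f) ⋙ fibre R p ⋙ (cartesianSquares R).Q ≅
      fibre R q ⋙ (cartesianSquares R).Q :=
  NatIso.ofComponents
    (fun s ↦ Localization.isoOfHom (cartesianSquares R).Q _ _ (fibreGlue_mem f s))
    (fun {s t} k ↦ by
      have h := congrArg (cartesianSquares R).Q.map ((fibreGlue R f).naturality k)
      exact ((cartesianSquares R).Q.map_comp _ _).symm.trans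
        (h.trans ((cartesianSquares R).Q.map_comp _ _)))

/-- Transformations between functors on the localization are given by compatible transformations
on the fibres. -/
lemma exists_natTrans_of_fibre {P P' : (cartesianSquares R).Localization ⥤ E}
    (ρ : ∀ p, fibre R p ⋙ (cartesianSquares R).Q ⋙ P ⟶ fibre R p ⋙ (cartesianSquares R).Q ⋙ P')
    (hρ : ∀ {p q : B} (f : p ⟶ q) (s : Over (R.obj q)),
      P.map ((glueIso R f).hom.app s) ≫ (ρ q).app s =
        (ρ p).app ((Over.pullback (R.map f)).obj s) ≫ P'.map ((glueIso R f).hom.app s)) :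
    ∃ σ : P ⟶ P', ∀ p s, σ.app ((cartesianSquares R).Q.obj ((fibre R p).obj s)) = (ρ p).app s := by
  let τ : (cartesianSquares R).Q ⋙ P ⟶ (cartesianSquares R).Q ⋙ P' :=
    { app := fun X ↦ (ρ X.right).app (Over.mk X.hom)
      naturality := fun X Y f ↦ naturality_of_fibre (F := (cartesianSquares R).Q ⋙ P)
        (F' := (cartesianSquares R).Q ⋙ P') (fun X ↦ (ρ X.right).app (Over.mk X.hom))
        (fun p s t k ↦ (ρ p).naturality k) (fun f s ↦ hρ f s) f }
  let e := Localization.fullyFaithfulWhiskeringLeft (cartesianSquares R).Q (cartesianSquares R) E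
  exact ⟨e.preimage τ, fun p s ↦ NatTrans.congr_app (e.map_preimage τ) ((fibre R p).obj s)⟩

end TotalLocalization

/-! ### Passing to inverses in the coherence conditions -/

section IsoAlgebra

variable {D : Type u₁} [Category.{v₁} D] {E : Type u₂} [Category.{v₂} E]

/-- The identity stands for the component of the associator in `SliceCocone.glue_comp`. -/
lemma comp_inv_eq_iff_of_iso {X Y Z T : D} (a : X ≅ T) (g : X ≅ Y) (f : Y ≅ Z) (m : Z ⟶ T) :
    m ≫ a.inv = f.inv ≫ g.inv ↔ a.hom = g.hom ≫ f.hom ≫ 𝟙 _ ≫ m := by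
  rw [Category.id_comp, Iso.comp_inv_eq, Category.assoc, Iso.eq_inv_comp, Iso.eq_inv_comp, eq_comm]

/-- The identities stand for the components of the associators in `SliceCocone.postcomp`. -/
lemma map_hom_comp_eq_iff {X Y : D} (i : X ≅ Y) (P P' : D ⥤ E) (r : P.obj X ⟶ P'.obj X)
    (r' : P.obj Y ⟶ P'.obj Y) :
    P.map i.hom ≫ r' = r ≫ P'.map i.hom ↔
      (P.map i.inv ≫ 𝟙 _) ≫ r = r' ≫ P'.map i.inv ≫ 𝟙 _ := by
  rw [Category.comp_id, Category.comp_id, ← Functor.mapIso_inv, ← Functor.mapIso_inv,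
    Iso.inv_comp_eq, ← Category.assoc, Iso.eq_comp_inv, Functor.mapIso_hom, Functor.mapIso_hom,
    eq_comm]

end IsoAlgebra

/-! ### The universal pseudococone -/

section TwoColimit

variable {C : Type u} [SmallCategory C] [HasPullbacks C]

lemma pullbackComp_inv_app_left_fst {X Y Z : C} (f : X ⟶ Y) (g : Y ⟶ Z) (s : Over Z) :
    ((Over.pullbackComp f g).inv.app s).left ≫ pullback.fst s.hom (f ≫ g) =
      pullback.fst (pullback.snd s.hom g) f ≫ pullback.fst s.hom g := by
  have h := congrArg CommaMorphism.left
    (conjugateEquiv_counit ((Over.mapPullbackAdj f).comp (Over.mapPullbackAdj g))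
      (Over.mapPullbackAdj (f ≫ g)) (Over.mapComp f g).hom s)
  simpa [Over.pullbackComp] using h

variable {K : C ⥤ Type u}

/-- The category whose objects are the pairs of a morphism `e ⟶ x` of `C` and an element of `K x`;
it is the total category of the slices `C/x` over `∫K`. -/
abbrev TotalSlice (K : C ⥤ Type u) : Type u := Comma (𝟭 C) (CategoryOfElements.π K)

/-- The 2-colimit of the slices: the localization of their total category at the cartesian
morphisms. -/
abbrev SliceColimit (K : C ⥤ Type u) : Type u :=
  (cartesianSquares (CategoryOfElements.π K)).Localization

/-- The localization functor from the total category of the slices to their 2-colimit. -/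
abbrev toColimit (K : C ⥤ Type u) : TotalSlice K ⥤ SliceColimit K :=
  (cartesianSquares (CategoryOfElements.π K)).Q

variable (K) in
/-- The pseudococone `φ_K^(x,a) : C/x ⥤ C_K`. -/
def colimitCocone : SliceCocone K (SliceColimit K) where
  leg p := fibre (CategoryOfElements.π K) p ⋙ toColimit K
  glue f := (glueIso (CategoryOfElements.π K) f).symm
  glue_comp {p q r} f g := by
    ext s
    refine (comp_inv_eq_iff_of_iso ((glueIso (CategoryOfElements.π K) (f ≫ g)).symm.app s)
      ((glueIso (CategoryOfElements.π K) g).symm.app s)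
      ((glueIso (CategoryOfElements.π K) f).symm.app ((Over.pullback g.1).obj s)) _).1 ?_
    have h := congrArg (toColimit K).map (fibreGlue_comp (R := CategoryOfElements.π K) f g s
      ((Over.pullbackComp f.1 g.1).inv.app s) (pullbackComp_inv_app_left_fst f.1 g.1 s))
    exact ((toColimit K).map_comp _ _).symm.trans (h.trans ((toColimit K).map_comp _ _))

namespace SliceCocone

variable {E : Type u} [SmallCategory E]

/-- A modification with invertible components is invertible. -/
def mkIso {ψ ψ' : SliceCocone K E} (e : ∀ p, ψ.leg p ≅ ψ'.leg p)
    (comm : ∀ {p q : K.Elements} (f : p ⟶ q),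
      (ψ.glue f).hom ≫ Functor.whiskerLeft (Over.pullback f.1) (e p).hom =
        (e q).hom ≫ (ψ'.glue f).hom) : ψ ≅ ψ' where
  hom := ⟨fun p ↦ (e p).hom, comm⟩
  inv := ⟨fun p ↦ (e p).inv, fun {p q} f ↦ by
    rw [← cancel_epi (e q).hom, ← reassoc_of% (comm f), Iso.hom_inv_id_assoc,
      ← Functor.whiskerLeft_comp]
    simp⟩
  hom_inv_id := by ext; simp
  inv_hom_id := by ext; simp

/-- A pseudococone, with the coherence for composition expressed on the inverses of the gluing
isomorphisms. -/
def toFibreCocone (ψ : SliceCocone K E) : FibreCocone (CategoryOfElements.π K) E where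
  leg := ψ.leg
  glue f := (ψ.glue f).symm
  glue_comp {p q r} f g s k hk := by
    obtain rfl : k = (Over.pullbackComp f.1 g.1).inv.app s :=
      hom_pullback_ext (hk.trans (pullbackComp_inv_app_left_fst f.1 g.1 s).symm)
    exact (comp_inv_eq_iff_of_iso ((ψ.glue (f ≫ g)).app s) ((ψ.glue g).app s)
      ((ψ.glue f).app ((Over.pullback g.1).obj s)) _).2 (NatTrans.congr_app (ψ.glue_comp f g) s)

/-- Compatibility of a family of transformations out of `colimitCocone K` with the gluing
isomorphisms, in terms of the isomorphisms `f⁻¹ s ≅ s`. -/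
lemma comm_iff (P : SliceColimit K ⥤ E) (ψ : SliceCocone K E)
    (e : ∀ p, ((colimitCocone K).postcomp P).leg p ⟶ ψ.leg p) {p q : K.Elements} (f : p ⟶ q) :
    (((colimitCocone K).postcomp P).glue f).hom ≫ Functor.whiskerLeft (Over.pullback f.1) (e p) =
        e q ≫ (ψ.glue f).hom ↔
      ∀ s, P.map ((glueIso (CategoryOfElements.π K) f).hom.app s) ≫ (e q).app s =
        (e p).app ((Over.pullback f.1).obj s) ≫ (ψ.glue f).inv.app s := by
  have key {X Y : SliceColimit K} {X' Y' : E} (i : X ≅ Y) (j : X' ≅ Y') (r : P.obj X ⟶ X')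
      (r' : P.obj Y ⟶ Y') : (P.map i.inv ≫ 𝟙 _) ≫ r = r' ≫ j.inv ↔
        P.map i.hom ≫ r' = r ≫ j.hom := by
    rw [Category.comp_id, ← Functor.mapIso_inv, Iso.inv_comp_eq, ← Category.assoc,
      Iso.eq_comp_inv, Functor.mapIso_hom, eq_comm]
  constructor
  · intro h s
    exact (key ((glueIso (CategoryOfElements.π K) f).app s) ((ψ.glue f).symm.app s) _ _).1
      (NatTrans.congr_app h s)
  · intro h
    ext s
    exact (key ((glueIso (CategoryOfElements.π K) f).app s) ((ψ.glue f).symm.app s) _ _).2 (h s)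

end SliceCocone

/-- The universal property of the localization: functors out of `C_K` are functors on the total
category which invert the cartesian morphisms, and these amount to pseudococones on its fibres. -/
theorem isTwoColimit_colimitCocone : (colimitCocone K).IsTwoColimit := fun E _ ↦
  { faithful := ⟨fun {P P'} τ τ' h ↦
      Localization.natTrans_ext (toColimit K) (cartesianSquares _) fun X ↦
        NatTrans.congr_app (congrArg (fun ρ ↦ SliceCocone.Hom.app ρ X.right) h) (Over.mk X.hom)⟩
    full := ⟨fun {P P'} ρ ↦ by
      obtain ⟨σ, hσ⟩ := exists_natTrans_of_fibre (R := CategoryOfElements.π K) (P := P) (P' := P')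
        ρ.app (fun {p q} f s ↦ (map_hom_comp_eq_iff ((glueIso (CategoryOfElements.π K) f).app s)
          P P' ((ρ.app p).app ((Over.pullback f.1).obj s)) ((ρ.app q).app s)).2
            (NatTrans.congr_app (ρ.comm f) s))
      refine ⟨σ, ?_⟩
      ext p s
      exact hσ p s⟩
    essSurj := ⟨fun ψ ↦ by
      let ψ' := ψ.toFibreCocone
      let e := Localization.fac ψ'.descend ψ'.isInvertedBy_descend (toColimit K)
      let P := Localization.lift ψ'.descend ψ'.isInvertedBy_descend (toColimit K)
      let e' (p : K.Elements) : ((colimitCocone K).postcomp P).leg p ≅ ψ.leg p :=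
        NatIso.ofComponents (fun s ↦ e.app ((fibre (CategoryOfElements.π K) p).obj s))
          (fun {s t} k ↦ (e.hom.naturality ((fibre (CategoryOfElements.π K) p).map k)).trans
            (congrArg _ (ψ'.descend_map_fibre p k)))
      exact ⟨P, ⟨SliceCocone.mkIso (ψ := (colimitCocone K).postcomp P) e' fun {p q} f ↦
        (SliceCocone.comm_iff P ψ (fun p ↦ (e' p).hom) f).2 fun s ↦
          (e.hom.naturality ((fibreGlue (CategoryOfElements.π K) f).app s)).trans
            (congrArg _ (ψ'.descend_map_fibreGlue f s))⟩⟩⟩ }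

end TwoColimit

/-! ### Constructions of `κ`-lex functors -/

section LexConstructions

variable {κ : Cardinal.{w}} {A : Type u₁} [Category.{v₁} A] {D : Type u₂} [Category.{v₂} D]

lemma IsLexFunctor.const_of_isTerminal {T : D} (hT : IsTerminal T) :
    IsLexFunctor κ ((Functor.const A).obj T) := fun _ _ _ ↦
  ⟨fun {_} ↦ ⟨fun _ ↦ ⟨⟨fun s ↦ hT.from s.pt, fun _ _ ↦ hT.hom_ext _ _,
    fun _ _ _ ↦ hT.hom_ext _ _⟩⟩⟩⟩

/-- Limits commute with limits: a pointwise pullback of `κ`-lex functors is `κ`-lex. -/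
lemma IsLexFunctor.pullback [HasPullbacks D] {F G H : A ⥤ D} (hF : IsLexFunctor κ F)
    (hG : IsLexFunctor κ G) (hH : IsLexFunctor κ H) (f : F ⟶ H) (g : G ⟶ H) :
    IsLexFunctor κ (Limits.pullback f g) := fun J _ hJ ↦ by
  have := hF J hJ
  have := hG J hJ
  have := hH J hJ
  have h (k : WalkingCospan) : PreservesLimitsOfShape J ((cospan f g).obj k) := by
    rcases k with _ | _ | _ <;> assumption
  have : PreservesLimitsOfShape J (cospan f g).flip := ⟨fun {_} ↦ ⟨fun {_} hc ↦
    ⟨evaluationJointlyReflectsLimits _ fun k ↦ isLimitOfPreserves ((cospan f g).obj k) hc⟩⟩⟩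
  exact preservesLimitsOfShape_of_natIso (limitIsoFlipCompLim (cospan f g)).symm

lemma IsLexFunctor.of_comp_comma {C : Type u} [Category.{v₃} C] {B : Type u₃} [Category.{w} B]
    {R : B ⥤ C} (hR : IsLexFunctor κ R) (F : A ⥤ Comma (𝟭 C) R)
    (h₁ : IsLexFunctor κ (F ⋙ Comma.fst _ _)) (h₂ : IsLexFunctor κ (F ⋙ Comma.snd _ _)) :
    IsLexFunctor κ F := fun J _ hJ ↦ by
  have := hR J hJ
  have := h₁ J hJ
  have := h₂ J hJ
  exact ⟨fun {_} ↦ ⟨fun {_} hc ↦ ⟨Comma.fstSndJointlyReflectLimit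
    (isLimitOfPreserves (F ⋙ Comma.fst _ _) hc) (isLimitOfPreserves (F ⋙ Comma.snd _ _) hc)⟩⟩⟩

end LexConstructions

/-! ### The `κ`-lex category `C_K` and the functor `φ_K` -/

section ColimitObject

variable {κ : Cardinal.{u}} {C : LexCat κ}

lemma isLexCategory_totalSlice (K : LexFun κ C) : IsLexCategory κ (TotalSlice K.obj) :=
  .comma C.isLex (C.isLex.elements K.property) (.elements_π C.isLex K.property)

section

variable {K K' : LexFun κ C}

/-- The functor between total categories of slices induced by `α : K ⟶ K'`. -/
def totalMap (α : K ⟶ K') : TotalSlice K.obj ⥤ TotalSlice K'.obj where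
  obj X := ⟨X.left, (CategoryOfElements.map α.hom).obj X.right, X.hom⟩
  map f := ⟨f.left, (CategoryOfElements.map α.hom).map f.right, f.w⟩

lemma isLexFunctor_totalMap (α : K ⟶ K') : IsLexFunctor κ (totalMap α) := by
  have hK := C.isLex.elements K.property
  have hπ := IsLexFunctor.elements_π C.isLex K.property
  refine .of_comp_comma (.elements_π C.isLex K'.property) _
    (.comma_fst C.isLex hK hπ) ((IsLexFunctor.comma_snd C.isLex hK hπ).comp
      (G := CategoryOfElements.map α.hom) fun J _ hJ ↦ ?_)
  have := C.isLex J hJ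
  have := K'.property J hJ
  have : PreservesLimitsOfShape J (CategoryOfElements.map α.hom ⋙ CategoryOfElements.π K'.obj) :=
    hπ J hJ
  exact preservesLimitsOfShape_of_reflects_of_preserves _ (CategoryOfElements.π K'.obj)

lemma isInvertedBy_totalMap (α : K ⟶ K') :
    (cartesianSquares (CategoryOfElements.π K.obj)).IsInvertedBy
      (totalMap α ⋙ toColimit K'.obj) := fun _ _ f hf ↦
  Localization.inverts (toColimit K'.obj) (cartesianSquares _) ((totalMap α).map f) hf

end

variable [Fact κ.IsRegular]

instance (K : LexFun κ C) : HasFiniteLimits K.obj.Elements :=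
  (C.isLex.elements K.property).hasFiniteLimits

/-- `K 1` is a singleton. -/
instance (K : LexFun κ C) : Unique (K.obj.obj (⊤_ (C : Type u))) :=
  haveI := K.property.preservesTerminal
  Types.isTerminalEquivUnique _ (IsTerminal.isTerminalObj K.obj _ terminalIsTerminal)

/-- The object `(1, *)` of the category of elements of `K`. -/
def basePoint (K : LexFun κ C) : K.obj.Elements := ⟨⊤_ (C : Type u), default⟩

/-- `(1, *)` is terminal in the category of elements of `K`. -/
def isTerminalBasePoint (K : LexFun κ C) : IsTerminal (basePoint K) :=
  IsTerminal.ofUniqueHom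
    (fun p ↦ ⟨terminal.from p.1, Subsingleton.elim (α := K.obj.obj (⊤_ (C : Type u))) _ _⟩)
    (fun _ _ ↦ Subtype.ext (terminalIsTerminal.hom_ext _ _))

lemma hasCommonRefinements_totalSlice (K : LexFun κ C) :
    HasCommonRefinements κ (cartesianSquares (CategoryOfElements.π K.obj)) :=
  hasCommonRefinements_cartesianSquares (C.isLex.elements K.property)

lemma isLexFunctor_toColimit (K : LexFun κ C) : IsLexFunctor κ (toColimit K.obj) :=
  isLexFunctor_of_isLocalization _ (isLexCategory_totalSlice K) (hasCommonRefinements_totalSlice K)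

lemma isLexFunctor_of_toColimit_comp (K : LexFun κ C) {D : Type u} [SmallCategory D]
    {F : SliceColimit K.obj ⥤ D} (hF : IsLexFunctor κ (toColimit K.obj ⋙ F)) : IsLexFunctor κ F :=
  isLexFunctor_of_comp_isLocalization _ (isLexCategory_totalSlice K)
    (hasCommonRefinements_totalSlice K) hF

/-- The functor which sends `e` to `e ⟶ 1` over `(1, *)`. -/
def toTotal (K : LexFun κ C) : C ⥤ TotalSlice K.obj :=
  toSliceTerminal C ⋙ fibre (CategoryOfElements.π K.obj) (basePoint K)

lemma isLexFunctor_toTotal (K : LexFun κ C) : IsLexFunctor κ (toTotal K) :=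
  .of_comp_comma (.elements_π C.isLex K.property) _ (.id κ C)
    (.const_of_isTerminal (isTerminalBasePoint K))

/-- The `κ`-lex functor `φ_K : C ⥤ C_K`. -/
def phi (K : LexFun κ C) : Coslice C where
  cod := ⟨SliceColimit K.obj, isLexCategory_of_isLocalization (toColimit K.obj)
    (isLexCategory_totalSlice K) (hasCommonRefinements_totalSlice K)⟩
  functor := toTotal K ⋙ toColimit K.obj
  isLex := (isLexFunctor_toTotal K).comp (isLexFunctor_toColimit K)

/-- `φ_K` as the leg of the colimit pseudocone at any element of `K 1`. -/
def phiIso (K : LexFun κ C) (t : K.obj.obj (⊤_ (C : Type u))) :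
    (phi K).functor ≅ toSliceTerminal C ⋙ (colimitCocone K.obj).leg ⟨⊤_ (C : Type u), t⟩ :=
  Functor.isoWhiskerLeft (toSliceTerminal C)
    (eqToIso (by rw [Subsingleton.elim t default]) :
      (colimitCocone K.obj).leg ⟨⊤_ (C : Type u), default⟩ ≅
        (colimitCocone K.obj).leg ⟨⊤_ (C : Type u), t⟩)

variable {K K' : LexFun κ C}

/-- The functor `C_α : C_K ⥤ C_K'`. -/
def colimitMap (α : K ⟶ K') : SliceColimit K.obj ⥤ SliceColimit K'.obj :=
  Localization.lift (totalMap α ⋙ toColimit K'.obj) (isInvertedBy_totalMap α) (toColimit K.obj)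

/-- `C_α` extends the functor between the total categories. -/
def toColimitCompColimitMap (α : K ⟶ K') :
    toColimit K.obj ⋙ colimitMap α ≅ totalMap α ⋙ toColimit K'.obj :=
  Localization.fac _ (isInvertedBy_totalMap α) _

/-- `C_α` is induced by the pseudococone `(φ_K'^(x, α_x a))`. -/
def colimitMapIso (α : K ⟶ K') :
    (colimitCocone K.obj).postcomp (colimitMap α) ≅ (colimitCocone K'.obj).restrict α.hom :=
  SliceCocone.mkIso (fun p ↦ Functor.isoWhiskerLeft (fibre (CategoryOfElements.π K.obj) p)
    (toColimitCompColimitMap α)) fun f ↦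
      (SliceCocone.comm_iff _ ((colimitCocone K'.obj).restrict α.hom)
        (fun p ↦ Functor.whiskerLeft (fibre (CategoryOfElements.π K.obj) p)
          (toColimitCompColimitMap α).hom) f).2 fun s ↦
        (toColimitCompColimitMap α).hom.naturality
          ((fibreGlue (CategoryOfElements.π K.obj) f).app s)

/-- The 1-cell `φ_K ⟶ φ_K'` induced by `α : K ⟶ K'`. -/
def phiMap (α : K ⟶ K') : phi K ⟶ phi K' :=
  Coslice.Hom.mk (M := phi K) (N := phi K') (colimitMap α)
    (isLexFunctor_of_toColimit_comp K (((isLexFunctor_totalMap α).comp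
      (isLexFunctor_toColimit K')).of_iso (toColimitCompColimitMap α).symm))
    (Functor.associator (toTotal K) (toColimit K.obj) (colimitMap α) ≪≫
      Functor.isoWhiskerLeft (toTotal K) (toColimitCompColimitMap α) ≪≫
        (phiIso K' (α.hom.app _ default)).symm)

end ColimitObject

/-! ### The unit `K ⟶ Γ φ_K` -/

section IdSlice

variable {C : Type u₁} [Category.{v₁} C] {B : Type u₂} [Category.{v₂} B] {R : B ⥤ C}

variable (R) in
/-- The identity slice object over `p`. -/
abbrev idSlice (p : B) : Comma (𝟭 C) R := ⟨R.obj p, p, 𝟙 _⟩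

/-- The functoriality of `idSlice`. -/
abbrev idSliceMap {p q : B} (f : p ⟶ q) : idSlice R p ⟶ idSlice R q :=
  ⟨R.map f, f, (Category.comp_id _).trans (Category.id_comp _).symm⟩

/-- The canonical morphism from `s : e ⟶ R p` to `𝟙 (R p)`. -/
abbrev toIdSlice (X : Comma (𝟭 C) R) : X ⟶ idSlice R X.right :=
  ⟨X.hom, 𝟙 _, congrArg (X.hom ≫ ·) (R.map_id _).symm⟩

lemma isIso_hom_of_cartesianSquares {X : Comma (𝟭 C) R} {p : B}
    {s : X ⟶ idSlice R p} (hs : cartesianSquares R s) : IsIso X.hom :=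
  have : IsIso (idSlice R p).hom := inferInstanceAs (IsIso (𝟙 (R.obj p)))
  IsPullback.isIso_snd_of_isIso hs

/-- If `X` has a cartesian map to an identity slice object, then `X.hom` is invertible, and its
inverse gives a morphism opposite to `toIdSlice X`. -/
lemma nonempty_idSlice_hom {X : Comma (𝟭 C) R} {p : B} {s : X ⟶ idSlice R p}
    (hs : cartesianSquares R s) : Nonempty (idSlice R X.right ⟶ X) := by
  have := isIso_hom_of_cartesianSquares hs
  have h : inv X.hom ≫ X.hom = 𝟙 _ := IsIso.inv_hom_id X.hom
  exact ⟨⟨inv X.hom, 𝟙 _, h.trans ((Category.id_comp _).trans (R.map_id _)).symm⟩⟩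

end IdSlice

section Unit

variable {κ : Cardinal.{u}} [Fact κ.IsRegular] {C : LexCat κ} {K : LexFun κ C}

/-- Morphisms to `(x ⟶ 1, *)` are determined by their underlying morphisms of `C`. -/
lemma toTotal_hom_ext {X : TotalSlice K.obj} {x : C} {f g : X ⟶ (toTotal K).obj x}
    (h : f.left = g.left) : f = g := by
  ext
  · exact h
  · exact congrArg Subtype.val ((isTerminalBasePoint K).hom_ext _ _)

/-- The morphism from `X` to `(x ⟶ 1, *)` with underlying morphism `f` of `C`. -/
def toTotalHom {X : TotalSlice K.obj} {x : C} (f : X.left ⟶ x) : X ⟶ (toTotal K).obj x :=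
  ⟨f, (isTerminalBasePoint K).from X.right, terminalIsTerminal.hom_ext _ _⟩

variable (K) in
/-- The canonical morphisms from `(e ⟶ x, a)` to `(e ⟶ 1, *)`. -/
def toBase : 𝟭 (TotalSlice K.obj) ⟶ Comma.fst _ _ ⋙ toTotal K where
  app X := toTotalHom (𝟙 X.left)
  naturality _ _ _ := toTotal_hom_ext ((Category.comp_id _).trans (Category.id_comp _).symm)

/-- Every object `(s : e ⟶ x, a)` is the pullback of `e` along the global element of `x` given
by `a`. -/
lemma isPullback_totalSlice (X : TotalSlice K.obj) :
    IsPullback ((toBase K).app X) (toIdSlice X) ((toTotal K).map X.hom)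
      ((toBase K).app (idSlice _ X.right)) where
  w := toTotal_hom_ext ((Category.id_comp _).trans (Category.comp_id _).symm)
  isLimit' := by
    have h (s : PullbackCone ((toTotal K).map X.hom) ((toBase K).app (idSlice _ X.right))) :
        s.fst.left ≫ X.hom = s.snd.left :=
      (congrArg CommaMorphism.left s.condition).trans (Category.comp_id _)
    exact ⟨PullbackCone.IsLimit.mk _
      (fun s ↦ ⟨s.fst.left, s.snd.right, (h s).trans ((Category.comp_id _).symm.trans s.snd.w)⟩)
      (fun s ↦ toTotal_hom_ext (Category.comp_id _))
      (fun s ↦ by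
        ext : 1
        · exact h s
        · exact Category.comp_id _)
      (fun s m h₁ h₂ ↦ by
        ext : 1
        · exact (Category.comp_id _).symm.trans (congrArg CommaMorphism.left h₁)
        · exact (Category.comp_id _).symm.trans (congrArg CommaMorphism.right h₂))⟩

/-- In `C_K`, the objects `(𝟙 x, a)` become terminal. -/
def isTerminalIdSlice (p : K.obj.Elements) : IsTerminal ((toColimit K.obj).obj (idSlice _ p)) := by
  let f : idSlice _ p ⟶ (toTotal K).obj (⊤_ C) := toTotalHom (terminal.from _)
  have hf : cartesianSquares _ f := by
    have : IsIso (((toTotal K).obj (⊤_ (C : Type u))).hom : (⊤_ (C : Type u)) ⟶ ⊤_ (C : Type u)) :=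
      isIso_of_isTerminal terminalIsTerminal terminalIsTerminal _
    have : IsIso (idSlice (CategoryOfElements.π K.obj) p).hom :=
      inferInstanceAs (IsIso (𝟙 ((CategoryOfElements.π K.obj).obj p)))
    exact IsPullback.of_vert_isIso ⟨f.w⟩
  have := (phi K).isLex.preservesTerminal
  exact (IsTerminal.isTerminalObj (phi K).functor _ terminalIsTerminal).ofIso
    (Localization.isoOfHom (toColimit K.obj) _ f hf).symm

variable (K) in
/-- The chosen terminal object of `C_K`. -/
def colimitTop : SliceColimit K.obj := ⊤_ (phi K).cod

variable (K) in
/-- `colimitTop K` is terminal. -/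
def isTerminalColimitTop : IsTerminal (colimitTop K) := terminalIsTerminal (C := (phi K).cod)

/-- The global element of `φ_K x` given by `a : K x`. -/
def unitApp {x : C} (a : K.obj.obj x) :
    colimitTop K ⟶ (toColimit K.obj).obj ((toTotal K).obj x) :=
  (isTerminalIdSlice (K.obj.elementsMk x a)).from _ ≫
    (toColimit K.obj).map ((toBase K).app (idSlice _ (K.obj.elementsMk x a)))

/-- A morphism `(𝟙 x, a) ⟶ (y ⟶ 1, *)` amounts to a morphism `f : x ⟶ y` of `C`; the image of `a`
under `K f`. -/
def evalHom {p : K.obj.Elements} {y : C} (f : idSlice _ p ⟶ (toTotal K).obj y) : K.obj.obj y :=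
  K.obj.map f.left p.2

lemma unitApp_evalHom {p : K.obj.Elements} {y : C} (f : idSlice _ p ⟶ (toTotal K).obj y)
    (j : colimitTop K ⟶ (toColimit K.obj).obj (idSlice _ p)) :
    unitApp (evalHom f) = j ≫ (toColimit K.obj).map f := by
  let q : K.obj.Elements := K.obj.elementsMk y (evalHom f)
  let g : p ⟶ q := CategoryOfElements.homMk _ _ f.left rfl
  have hg : idSliceMap g ≫ (toBase K).app (idSlice _ q) = f :=
    toTotal_hom_ext (Category.comp_id _)
  have hj : (isTerminalIdSlice q).from _ = j ≫ (toColimit K.obj).map (idSliceMap g) :=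
    (isTerminalIdSlice q).hom_ext _ _
  exact (congrArg (· ≫ _) hj).trans ((Category.assoc _ _ _).trans (congrArg (j ≫ ·)
    (((toColimit K.obj).map_comp _ _).symm.trans (congrArg (toColimit K.obj).map hg))))

/-- Injectivity of the unit, in terms of representatives: by the calculus of fractions `f` and `g`
agree after composition with a cartesian map `s : X ⟶ idSlice p`; hence so do their underlying
morphisms after composition with `s.right`, along which the element `p.2` is an image. -/
lemma evalHom_eq_of_map_eq {p : K.obj.Elements} {y : C} {f g : idSlice _ p ⟶ (toTotal K).obj y}
    (h : (toColimit K.obj).map f = (toColimit K.obj).map g) : evalHom f = evalHom g := by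
  obtain ⟨X, s, hs, h⟩ := (MorphismProperty.map_eq_iff_precomp _
    (cartesianSquares (CategoryOfElements.π K.obj)) _ _).1 h
  have := isIso_hom_of_cartesianSquares hs
  have h₁ : s.left ≫ f.left = s.left ≫ g.left := congrArg CommaMorphism.left h
  have h₂ : s.left = X.hom ≫ s.right.1 := (Category.comp_id _).symm.trans s.w
  have h₃ : s.right.1 ≫ f.left = s.right.1 ≫ g.left := by
    refine (cancel_epi X.hom).1 ((Category.assoc _ _ _).symm.trans (Eq.trans ?_
      (Category.assoc _ _ _)))
    exact (congrArg (· ≫ f.left) h₂).symm.trans (h₁.trans (congrArg (· ≫ g.left) h₂))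
  have h₄ (k : idSlice _ p ⟶ (toTotal K).obj y) :
      evalHom k = K.obj.map (s.right.1 ≫ k.left) X.right.2 :=
    (congrArg _ s.right.2.symm).trans (Functor.map_comp_apply _ _ _ _).symm
  rw [h₄, h₄]
  exact congrArg (fun k ↦ K.obj.map k X.right.2) h₃

/-- The elements `a` and `b` of `K x` are the images of one element of `∫K` under two morphisms to
`x`, namely the projections from the product of `(x, a)` and `(x, b)`. -/
lemma unitApp_injective (x : C) :
    Function.Injective (unitApp (K := K) (x := x)) := fun a b h ↦ by
  let p : K.obj.Elements := K.obj.elementsMk x a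
  let q : K.obj.Elements := K.obj.elementsMk x b
  let f : p ⨯ q ⟶ p := prod.fst
  let g : p ⨯ q ⟶ q := prod.snd
  let f' : idSlice _ (p ⨯ q) ⟶ (toTotal K).obj x := toTotalHom f.1
  let g' : idSlice _ (p ⨯ q) ⟶ (toTotal K).obj x := toTotalHom g.1
  have hf : evalHom f' = a := f.2
  have hg : evalHom g' = b := g.2
  rw [← hf, ← hg] at h ⊢
  let j := (isTerminalIdSlice (p ⨯ q)).from (colimitTop K)
  have : IsIso j := isIso_of_isTerminal (isTerminalColimitTop K) (isTerminalIdSlice _) _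
  have h' : j ≫ (toColimit K.obj).map f' = j ≫ (toColimit K.obj).map g' :=
    (unitApp_evalHom f' j).symm.trans (h.trans (unitApp_evalHom g' j))
  exact evalHom_eq_of_map_eq ((cancel_epi j).1 h')

/-- A global element of `φ_K x` is a fraction whose denominator is a cartesian map to the object
`(𝟙 1, *)`, so that the source of the fraction is isomorphic to some `(𝟙 y, b)`. -/
lemma unitApp_surjective {x : C} (σ : colimitTop K ⟶ (toColimit K.obj).obj ((toTotal K).obj x)) :
    ∃ a : K.obj.obj x, unitApp a = σ := by
  obtain ⟨X, s, f, hs, hf⟩ := exists_fraction (toColimit K.obj) (cartesianSquares _)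
    (X := idSlice _ (basePoint K)) (Y := (toTotal K).obj x) ((isTerminalColimitTop K).from _ ≫ σ)
  obtain ⟨r⟩ := nonempty_idSlice_hom hs
  let j := (isTerminalIdSlice X.right).from (colimitTop K)
  refine ⟨evalHom (r ≫ f), (unitApp_evalHom (r ≫ f) j).trans ?_⟩
  have h : j ≫ (toColimit K.obj).map r ≫ (toColimit K.obj).map s ≫
    (isTerminalColimitTop K).from _ = 𝟙 _ := (isTerminalColimitTop K).hom_ext _ _
  rw [Functor.map_comp, ← hf]
  simpa only [Category.assoc, Category.id_comp] using congrArg (· ≫ σ) h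

variable (K) in
/-- The unit `K ⟶ Γ φ_K`. -/
def unitMap : K ⟶ gammaObj (phi K) :=
  ObjectProperty.homMk
    { app := fun x ↦ ↾fun a ↦ unitApp a
      naturality := fun x y f ↦ by
        ext a
        let f' : idSlice _ (K.obj.elementsMk x a) ⟶ (toTotal K).obj y := toTotalHom f
        have hf : f' = (toBase K).app (idSlice _ (K.obj.elementsMk x a)) ≫ (toTotal K).map f :=
          toTotal_hom_ext (Category.id_comp f).symm
        exact (unitApp_evalHom f' ((isTerminalIdSlice _).from _)).trans
          ((congrArg (_ ≫ ·) ((congrArg (toColimit K.obj).map hf).trans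
            ((toColimit K.obj).map_comp _ _))).trans (Category.assoc _ _ _).symm) }

instance : IsIso (unitMap K) := by
  have h (x : C) : IsIso ((unitMap K).hom.app x) :=
    (isIso_iff_bijective _).2 ⟨unitApp_injective x, unitApp_surjective⟩
  have : IsIso ((ObjectProperty.ι _).map (unitMap K)) := NatIso.isIso_of_isIso_app (unitMap K).hom
  exact isIso_of_reflects_iso _ (ObjectProperty.ι _)

/-- The value of `Γ F` on the unit, computed with an arbitrary map from the terminal object. -/
lemma gammaMap_unitMap_app {N : Coslice C} (F : phi K ⟶ N) {x : C} (a : K.obj.obj x)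
    (j : ⊤_ N.cod ⟶ F.functor.obj ((toColimit K.obj).obj (idSlice _ (K.obj.elementsMk x a)))) :
    (unitMap K ≫ gammaMap F).hom.app x a =
      j ≫ F.functor.map ((toColimit K.obj).map
        ((toBase K).app (idSlice _ (K.obj.elementsMk x a)))) ≫ F.ν.hom.app x := by
  have := F.isLex.preservesTerminal
  have key {A D : Type u} [SmallCategory A] [SmallCategory D] (F : A ⥤ D) {X Y Z : A} {T T' : D}
      (t : T ⟶ F.obj X) (i : X ⟶ Y) (m : Y ⟶ Z) (n : F.obj Z ⟶ T') (j : T ⟶ F.obj Y)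
      (h : t ≫ F.map i = j) : t ≫ F.map (i ≫ m) ≫ n = j ≫ F.map m ≫ n := by
    simp [← h]
  exact key F.functor (terminalMap F) ((isTerminalIdSlice _).from _) _ (F.ν.hom.app x) j
    ((IsTerminal.isTerminalObj F.functor _ (isTerminalIdSlice _)).hom_ext _ _)

lemma phiIso_inv_app (t : K.obj.obj (⊤_ (C : Type u))) (x : C)
    (f : (fibre (CategoryOfElements.π K.obj) (K.obj.elementsMk _ t)).obj
      ((toSliceTerminal C).obj x) ⟶ (toTotal K).obj x) (hf : f.left = 𝟙 x) :
    (phiIso K t).inv.app x = (toColimit K.obj).map f := by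
  obtain rfl := Subsingleton.elim default t
  obtain rfl : f = 𝟙 _ := toTotal_hom_ext hf
  exact ((toColimit K.obj).map_id _).symm

/-- Naturality of the unit. -/
lemma unitMap_naturality {K' : LexFun κ C} (α : K ⟶ K') :
    unitMap K ≫ gammaMap (phiMap α) = α ≫ unitMap K' := by
  refine gamma_hom_ext fun x a ↦ ?_
  let p : K.obj.Elements := K.obj.elementsMk x a
  let q : K'.obj.Elements := K'.obj.elementsMk x (α.hom.app x a)
  let e := toColimitCompColimitMap α
  let j := (isTerminalIdSlice q).from (colimitTop K')
  let b := (totalMap α).map ((toBase K).app (idSlice _ p))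
  let c : (totalMap α).obj ((toTotal K).obj x) ⟶ (toTotal K').obj x := toTotalHom (𝟙 x)
  have hb : b ≫ c = (toBase K').app (idSlice _ q) := toTotal_hom_ext (Category.comp_id _)
  have hn := e.hom.naturality ((toBase K).app (idSlice _ p))
  refine (gammaMap_unitMap_app (phiMap α) a (j ≫ e.inv.app (idSlice _ p))).trans ?_
  have hν : (phiMap α).ν.hom.app x = 𝟙 _ ≫ e.hom.app ((toTotal K).obj x) ≫
    (toColimit K'.obj).map c := congrArg (fun k ↦ 𝟙 _ ≫ e.hom.app ((toTotal K).obj x) ≫ k)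
      (phiIso_inv_app _ x c rfl)
  have key {D : Type u} [SmallCategory D] {T X X' Y Y' Z : D} (j : T ⟶ X') (i : X ≅ X')
      (m : X ⟶ Y) (i' : Y ⟶ Y') (m' : X' ⟶ Y') (c : Y' ⟶ Z) (n : X' ⟶ Z) (v : Y ⟶ Z)
      (h₁ : m ≫ i' = i.hom ≫ m') (h₂ : m' ≫ c = n) (h₃ : v = 𝟙 _ ≫ i' ≫ c) :
      (j ≫ i.inv) ≫ m ≫ v = j ≫ n := by
    simp [← h₂, h₃, reassoc_of% h₁]
  exact key (D := SliceColimit K'.obj) j (e.app (idSlice _ p)) _ _ _ _ _ _ hn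
    (((toColimit K'.obj).map_comp _ _).symm.trans (congrArg _ hb)) hν

end Unit

/-! ### 1-cells out of `φ_K` -/

section HomEquiv

variable {κ : Cardinal.{u}} [Fact κ.IsRegular] {C : LexCat κ} {K : LexFun κ C} {N : Coslice C}

/-- The global element of `N x` which `α : K ⟶ Γ N` assigns to `p = (x, a)`. -/
def globalElement (α : K ⟶ gammaObj N) (p : K.obj.Elements) :
    ⊤_ N.cod ⟶ N.functor.obj ((CategoryOfElements.π K.obj).obj p) :=
  α.hom.app p.1 p.2

lemma globalElement_map (α : K ⟶ gammaObj N) {p q : K.obj.Elements} (f : p ⟶ q) :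
    globalElement α p ≫ N.functor.map ((CategoryOfElements.π K.obj).map f) = globalElement α q :=
  (NatTrans.naturality_apply α.hom f.1 p.2).symm.trans (congrArg (α.hom.app q.1) f.2)

variable (K N) in
/-- The transformation with component `N s : N e ⟶ N x` at `(s : e ⟶ x, a)`. -/
def mapHom : Comma.fst (𝟭 C) (CategoryOfElements.π K.obj) ⋙ N.functor ⟶
    Comma.snd (𝟭 C) (CategoryOfElements.π K.obj) ⋙ CategoryOfElements.π K.obj ⋙ N.functor where
  app X := N.functor.map X.hom
  naturality _ _ f := (N.functor.map_comp _ _).symm.trans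
    ((congrArg N.functor.map f.w).trans (N.functor.map_comp _ _))

/-- The transformation with component `α a : 1 ⟶ N x` at `(s : e ⟶ x, a)`. -/
def globalElementHom (α : K ⟶ gammaObj N) : (Functor.const (TotalSlice K.obj)).obj (⊤_ N.cod) ⟶
    Comma.snd (𝟭 C) (CategoryOfElements.π K.obj) ⋙ CategoryOfElements.π K.obj ⋙ N.functor where
  app X := globalElement α X.right
  naturality _ _ f := (Category.id_comp _).trans (globalElement_map α f.right).symm

/-- The functor which sends `(s : e ⟶ x, a)` to the pullback of `N s : N e ⟶ N x` along
`α a : 1 ⟶ N x`. -/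
def pullbackFunctor (α : K ⟶ gammaObj N) : TotalSlice K.obj ⥤ N.cod :=
  pullback (mapHom K N) (globalElementHom α)

/-- The projection from the pullback of `N s` along `α a` to `N e`. -/
def pullbackFunctorFst (α : K ⟶ gammaObj N) :
    pullbackFunctor α ⟶ Comma.fst (𝟭 C) (CategoryOfElements.π K.obj) ⋙ N.functor :=
  pullback.fst _ _

lemma isPullback_pullbackFunctor (α : K ⟶ gammaObj N) (X : TotalSlice K.obj) :
    IsPullback ((pullbackFunctorFst α).app X) (terminal.from _) (N.functor.map X.hom)
      (globalElement α X.right) := by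
  have h := (IsPullback.of_hasPullback (mapHom K N) (globalElementHom α)).map
    ((evaluation _ _).obj X)
  have hs : (pullback.snd (mapHom K N) (globalElementHom α)).app X =
    terminal.from ((pullbackFunctor α).obj X) := terminalIsTerminal.hom_ext _ _
  exact hs ▸ h

lemma pullbackFunctor_hom_ext (α : K ⟶ gammaObj N) {X : TotalSlice K.obj} {d : N.cod}
    {f g : d ⟶ (pullbackFunctor α).obj X}
    (h : f ≫ (pullbackFunctorFst α).app X = g ≫ (pullbackFunctorFst α).app X) : f = g :=
  (isPullback_pullbackFunctor α X).hom_ext h (terminalIsTerminal.hom_ext _ _)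

lemma isLexFunctor_pullbackFunctor (α : K ⟶ gammaObj N) : IsLexFunctor κ (pullbackFunctor α) := by
  have hK := C.isLex.elements K.property
  have hπ := IsLexFunctor.elements_π C.isLex K.property
  exact .pullback ((IsLexFunctor.comma_fst C.isLex hK hπ).comp N.isLex)
    (.const_of_isTerminal terminalIsTerminal)
    ((IsLexFunctor.comma_snd C.isLex hK hπ).comp (hπ.comp N.isLex)) _ _

lemma isInvertedBy_pullbackFunctor (α : K ⟶ gammaObj N) :
    (cartesianSquares (CategoryOfElements.π K.obj)).IsInvertedBy (pullbackFunctor α) :=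
  fun X Y f hf ↦ by
    have := N.isLex.preservesFiniteLimits
    have hf' : IsPullback (N.functor.map f.left) (N.functor.map X.hom) (N.functor.map Y.hom)
      (N.functor.map ((CategoryOfElements.π K.obj).map f.right)) := IsPullback.map N.functor hf
    have hX := (isPullback_pullbackFunctor α X).paste_horiz hf'
    have hY := isPullback_pullbackFunctor α Y
    rw [globalElement_map] at hX
    have h : (pullbackFunctor α).map f = (hX.isoIsPullback _ _ hY).hom := by
      refine pullbackFunctor_hom_ext α ?_
      rw [hX.isoIsPullback_hom_fst _ _ hY]
      exact (pullbackFunctorFst α).naturality f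
    rw [h]
    infer_instance

/-- `N ≅ pullbackFunctor α ∘ toTotal`: the pullback over the terminal object `N 1`. -/
def toTotalCompPullbackFunctor (α : K ⟶ gammaObj N) :
    toTotal K ⋙ pullbackFunctor α ≅ N.functor :=
  have h (x : C) : IsIso ((pullbackFunctorFst α).app ((toTotal K).obj x)) := by
    have := N.isLex.preservesTerminal
    have : IsIso (globalElement α ((toTotal K).obj x).right) :=
      isIso_of_isTerminal terminalIsTerminal
        (IsTerminal.isTerminalObj N.functor (⊤_ (C : Type u)) terminalIsTerminal) _
    exact (isPullback_pullbackFunctor α ((toTotal K).obj x)).isIso_fst_of_isIso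
  NatIso.ofComponents (fun x ↦ @asIso _ _ _ _ _ (h x))
    (fun f ↦ (pullbackFunctorFst α).naturality ((toTotal K).map f))

/-- The functor `C_K ⥤ N.cod` induced by `pullbackFunctor α`. -/
def extendFunctor (α : K ⟶ gammaObj N) : SliceColimit K.obj ⥤ N.cod :=
  Localization.lift (pullbackFunctor α) (isInvertedBy_pullbackFunctor α) (toColimit K.obj)

/-- `extendFunctor α` extends `pullbackFunctor α`. -/
def toColimitCompExtendFunctor (α : K ⟶ gammaObj N) :
    toColimit K.obj ⋙ extendFunctor α ≅ pullbackFunctor α :=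
  Localization.fac _ _ _

/-- The 1-cell `φ_K ⟶ N` which corresponds to `α : K ⟶ Γ N`. -/
def extend (α : K ⟶ gammaObj N) : phi K ⟶ N :=
  Coslice.Hom.mk (M := phi K)
    (extendFunctor α)
    (isLexFunctor_of_toColimit_comp K
      ((isLexFunctor_pullbackFunctor α).of_iso (toColimitCompExtendFunctor α).symm))
    (Functor.associator _ _ _ ≪≫
      Functor.isoWhiskerLeft (toTotal K) (toColimitCompExtendFunctor α) ≪≫
        toTotalCompPullbackFunctor α)

lemma extend_ν_hom_app (α : K ⟶ gammaObj N) (x : C) : (extend α).ν.hom.app x =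
    (toColimitCompExtendFunctor α).hom.app ((toTotal K).obj x) ≫
      (pullbackFunctorFst α).app ((toTotal K).obj x) :=
  Category.id_comp _

lemma unitMap_comp_gammaMap_extend (α : K ⟶ gammaObj N) :
    unitMap K ≫ gammaMap (extend α) = α := by
  refine gamma_hom_ext fun x a ↦ ?_
  let p : K.obj.Elements := K.obj.elementsMk x a
  let e := toColimitCompExtendFunctor α
  have hp := isPullback_pullbackFunctor α (idSlice _ p)
  obtain ⟨l, hl, -⟩ := hp.exists_lift (globalElement α p) (𝟙 _)
    ((congrArg (globalElement α p ≫ ·) (N.functor.map_id _)).trans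
      ((Category.comp_id _).trans (Category.id_comp _).symm))
  refine (gammaMap_unitMap_app (extend α) a (l ≫ e.inv.app (idSlice _ p))).trans ?_
  have hn := e.hom.naturality ((toBase K).app (idSlice _ p))
  have hn' := (pullbackFunctorFst α).naturality ((toBase K).app (idSlice _ p))
  have key {D : Type u} [SmallCategory D] {T X X' Y Y' Z : D} (j : T ⟶ X') (i : X ≅ X')
      (m : X ⟶ Y) (i' : Y ⟶ Y') (m' : X' ⟶ Y') (c : Y' ⟶ Z) (n : X' ⟶ Z) (v : Y ⟶ Z) (r : T ⟶ Z)
      (h₁ : m ≫ i' = i.hom ≫ m') (h₂ : m' ≫ c = n) (h₃ : v = i' ≫ c) (h₄ : j ≫ n = r) :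
      (j ≫ i.inv) ≫ m ≫ v = r := by
    simp [← h₂, h₃, reassoc_of% h₁, ← h₄]
  exact key l (e.app (idSlice _ p)) _ _ _ _ _ _ _ hn
    (hn'.trans ((congrArg (_ ≫ ·) (N.functor.map_id x)).trans (Category.comp_id _)))
    (extend_ν_hom_app α x) hl

/-- The functor on the total category underlying a 1-cell out of `φ_K`. -/
def restrictTotal (F : phi K ⟶ N) : TotalSlice K.obj ⥤ N.cod := toColimit K.obj ⋙ F.functor

/-- The component at `(s : e ⟶ x, a)` is the map from `F (s, a)` to `F φ_K e ≅ N e`. -/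
def restrictTotalFst (F : phi K ⟶ N) :
    restrictTotal F ⟶ Comma.fst (𝟭 C) (CategoryOfElements.π K.obj) ⋙ N.functor :=
  Functor.whiskerRight (toBase K) (restrictTotal F) ≫
    Functor.whiskerLeft (Comma.fst (𝟭 C) (CategoryOfElements.π K.obj)) F.ν.hom

lemma restrictTotalFst_app (F : phi K ⟶ N) (X : TotalSlice K.obj) :
    (restrictTotalFst F).app X =
      (restrictTotal F).map ((toBase K).app X) ≫ F.ν.hom.app X.left := rfl

/-- A `κ`-lex functor on `C_K` preserves the pullback squares which describe the objects of
`C_K`. -/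
lemma isPullback_restrictTotal (F : phi K ⟶ N) {α : K ⟶ gammaObj N}
    (hF : unitMap K ≫ gammaMap F = α) (X : TotalSlice K.obj) :
    IsPullback ((restrictTotalFst F).app X) (terminal.from _) (N.functor.map X.hom)
      (globalElement α X.right) := by
  have hlex : IsLexFunctor κ (restrictTotal F) := (isLexFunctor_toColimit K).comp F.isLex
  have := hlex.preservesFiniteLimits
  have := F.isLex.preservesTerminal
  have ht : IsTerminal ((restrictTotal F).obj (idSlice _ X.right)) :=
    IsTerminal.isTerminalObj F.functor _ (isTerminalIdSlice X.right)
  let i := ht.uniqueUpToIso (terminalIsTerminal (C := N.cod))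
  let n (x : C) : (restrictTotal F).obj ((toTotal K).obj x) ≅ N.functor.obj x := F.ν.app x
  have hα : globalElement α X.right = i.inv ≫ (restrictTotal F).map
      ((toBase K).app (idSlice _ X.right)) ≫ (n _).hom := by
    subst hF
    exact gammaMap_unitMap_app F X.right.2 i.inv
  refine ((isPullback_totalSlice X).map (restrictTotal F)).of_iso (Iso.refl _) (n X.left) i
    (n ((CategoryOfElements.π K.obj).obj X.right)) ?_ (terminalIsTerminal.hom_ext _ _) ?_ ?_
  · exact (Category.id_comp _).symm
  · exact F.ν.hom.naturality X.hom
  · rw [hα, Iso.hom_inv_id_assoc]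
    rfl

/-- A 1-cell out of `φ_K` is determined on the total category by its image under `Γ`. -/
def restrictTotalIso (F : phi K ⟶ N) {α : K ⟶ gammaObj N} (hF : unitMap K ≫ gammaMap F = α) :
    restrictTotal F ≅ pullbackFunctor α :=
  let s : restrictTotal F ⟶ (Functor.const (TotalSlice K.obj)).obj (⊤_ N.cod) :=
    { app := fun _ ↦ terminal.from _
      naturality := fun _ _ _ ↦ terminalIsTerminal.hom_ext _ _ }
  let c : restrictTotal F ⟶ pullbackFunctor α := pullback.lift (restrictTotalFst F) s (by
    ext X
    exact (isPullback_restrictTotal F hF X).w)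
  have hc (X : TotalSlice K.obj) : c.app X = ((isPullback_restrictTotal F hF X).isoIsPullback _ _
      (isPullback_pullbackFunctor α X)).hom := by
    refine pullbackFunctor_hom_ext α ?_
    rw [IsPullback.isoIsPullback_hom_fst]
    exact NatTrans.congr_app (pullback.lift_fst (restrictTotalFst F) s _) X
  have : ∀ X, IsIso (c.app X) := fun X ↦ by
    rw [hc]
    infer_instance
  have := NatIso.isIso_of_isIso_app c
  asIso c

lemma restrictTotalIso_hom_fst (F : phi K ⟶ N) {α : K ⟶ gammaObj N}
    (hF : unitMap K ≫ gammaMap F = α) :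
    (restrictTotalIso F hF).hom ≫ pullbackFunctorFst α = restrictTotalFst F :=
  pullback.lift_fst _ _ _

/-- 2-cells out of `φ_K` preserve the projections to `N e`. -/
lemma hom₂_comp_restrictTotalFst {F G : phi K ⟶ N} (θ : F ⟶ G) :
    Functor.whiskerLeft (toColimit K.obj) θ.iso.hom ≫ restrictTotalFst G = restrictTotalFst F := by
  ext X
  have h₁ := θ.w_app X.left
  have h₂ := θ.iso.hom.naturality ((toColimit K.obj).map ((toBase K).app X))
  have key {D : Type u} [SmallCategory D] {X Y X' Y' Z : D} (t : X ⟶ Y) (t' : X' ⟶ Y')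
      (f : X ⟶ X') (g : Y ⟶ Y') (n : X' ⟶ Z) (n' : Y' ⟶ Z) (h₁ : t' ≫ n' = n)
      (h₂ : f ≫ t' = t ≫ g) : t ≫ g ≫ n' = f ≫ n := by
    rw [← h₁, reassoc_of% h₂]
  exact key _ _ _ _ _ _ h₁ h₂

/-- There is at most one 2-cell between two 1-cells out of `φ_K`. -/
instance (F G : phi K ⟶ N) : Subsingleton (F ⟶ G) := ⟨fun θ η ↦ by
  have h : Functor.whiskerLeft (toColimit K.obj) θ.iso.hom =
      Functor.whiskerLeft (toColimit K.obj) η.iso.hom := by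
    let e := restrictTotalIso G rfl
    refine (cancel_mono (f := (e.hom : toColimit K.obj ⋙ G.functor ⟶ _))).1 ?_
    ext X
    refine pullbackFunctor_hom_ext (unitMap K ≫ gammaMap G) ?_
    have he := NatTrans.congr_app (restrictTotalIso_hom_fst G rfl) X
    have hθ := NatTrans.congr_app (hom₂_comp_restrictTotalFst θ) X
    have hη := NatTrans.congr_app (hom₂_comp_restrictTotalFst η) X
    refine (Category.assoc _ _ _).trans (Eq.trans ?_ (Category.assoc _ _ _).symm)
    exact (congrArg (_ ≫ ·) he).trans (hθ.trans (hη.symm.trans (congrArg (_ ≫ ·) he).symm))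
  refine Coslice.Hom₂.ext (Iso.ext ?_)
  exact Localization.natTrans_ext (toColimit K.obj) (cartesianSquares _) fun X ↦
    NatTrans.congr_app h X⟩

/-- Two 1-cells out of `φ_K` with the same image under `Γ` are isomorphic. -/
lemma nonempty_iso_of_gammaMap_eq {F G : phi K ⟶ N}
    (h : unitMap K ≫ gammaMap F = unitMap K ≫ gammaMap G) : Nonempty (F ≅ G) := by
  let e : toColimit K.obj ⋙ F.functor ≅ toColimit K.obj ⋙ G.functor :=
    restrictTotalIso F h ≪≫ (restrictTotalIso G rfl).symm
  let W := Localization.fullyFaithfulWhiskeringLeft (toColimit K.obj)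
    (cartesianSquares (CategoryOfElements.π K.obj)) N.cod
  have he : e.hom ≫ restrictTotalFst G = restrictTotalFst F := by
    rw [← restrictTotalIso_hom_fst F h, ← restrictTotalIso_hom_fst G rfl]
    exact (Category.assoc _ _ _).trans (congrArg (_ ≫ ·) (Iso.inv_hom_id_assoc _ _))
  refine ⟨Coslice.mkIso (W.preimageIso e) fun x ↦ ?_⟩
  have h₁ := NatTrans.congr_app (W.map_preimage e.hom) ((toTotal K).obj x)
  have h₂ := NatTrans.congr_app he ((toTotal K).obj x)
  have h₃ (H : phi K ⟶ N) : (restrictTotalFst H).app ((toTotal K).obj x) = H.ν.hom.app x := by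
    have : (toBase K).app ((toTotal K).obj x) = 𝟙 _ := toTotal_hom_ext rfl
    rw [restrictTotalFst_app, this]
    exact (congrArg (· ≫ _) ((restrictTotal H).map_id _)).trans (Category.id_comp _)
  exact (congrArg (· ≫ _) h₁).trans ((congrArg (_ ≫ ·) (h₃ G).symm).trans (h₂.trans (h₃ F)))

end HomEquiv

/-! ### The adjunction -/

section Adjoint

variable {κ : Cardinal.{u}} [Fact κ.IsRegular] {C : LexCat κ}

/-- The functor from 1-cells `φ_K ⟶ N` to morphisms `K ⟶ Γ N` given by the unit. -/
def transpose (K : LexFun κ C) (N : Coslice C) :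
    (phi K ⟶ N) ⥤ ((⟨K⟩ : LocallyDiscrete (LexFun κ C)) ⟶ (gamma C).obj N) where
  obj F := ⟨unitMap K ≫ gammaMap F⟩
  map θ := Discrete.eqToHom (congrArg (unitMap K ≫ ·) (gammaMap_congr θ))
  map_id _ := Subsingleton.elim _ _
  map_comp _ _ := Subsingleton.elim _ _

instance (K : LexFun κ C) (N : Coslice C) : (transpose K N).IsEquivalence where
  faithful := ⟨fun _ ↦ Subsingleton.elim _ _⟩
  full := ⟨fun f ↦
    ⟨(nonempty_iso_of_gammaMap_eq (Discrete.eq_of_hom f)).some.hom, Subsingleton.elim _ _⟩⟩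
  essSurj := ⟨fun α ↦ ⟨extend α.as, ⟨Discrete.eqToIso (unitMap_comp_gammaMap_extend α.as)⟩⟩⟩

variable (C) in
/-- The pseudofunctor `K ↦ φ_K`. Its structure isomorphisms exist because `Γ` distinguishes
1-cells out of `φ_K` up to isomorphism; they are coherent because parallel 2-cells out of `φ_K`
are equal. -/
def sliceColimit : LocallyDiscrete (LexFun κ C) ⥤ᵖ Coslice C where
  obj K := phi K.as
  map α := phiMap α.as
  map₂ θ := eqToHom (congrArg phiMap (Discrete.eq_of_hom θ))
  mapId K := (nonempty_iso_of_gammaMap_eq (F := phiMap (𝟙 K.as)) (G := 𝟙 (phi K.as)) (by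
    rw [unitMap_naturality, gammaMap_id, Category.id_comp, Category.comp_id])).some
  mapComp α β := (nonempty_iso_of_gammaMap_eq (F := phiMap (α.as ≫ β.as))
    (G := phiMap α.as ≫ phiMap β.as) (by
      rw [unitMap_naturality, gammaMap_comp, ← Category.assoc, unitMap_naturality, Category.assoc,
        Category.assoc, unitMap_naturality])).some
  map₂_id _ := Subsingleton.elim _ _
  map₂_comp _ _ := Subsingleton.elim _ _
  map₂_whisker_left _ _ _ _ := Subsingleton.elim _ _
  map₂_whisker_right _ _ := Subsingleton.elim _ _
  map₂_associator _ _ _ := Subsingleton.elim _ _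
  map₂_left_unitor _ := Subsingleton.elim _ _
  map₂_right_unitor _ := Subsingleton.elim _ _

variable (C) in
/-- The description of `sliceColimit` as a 2-colimit of slices. -/
def sliceColimitData : SliceColimitData (sliceColimit C) where
  cocone K := colimitCocone K.obj
  isTwoColimit K := isTwoColimit_colimitCocone
  baseIso := phiIso
  mapIso := colimitMapIso
  mapIso_base {K K'} α t := by
    -- At the chosen element of `K 1`, `phiIso` is the identity.
    obtain rfl := Subsingleton.elim default t
    have key {D : Type u} [SmallCategory D] {X Y Z : D} (m : X ⟶ Y) (i : Z ≅ Y) (r : X ⟶ X)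
        (h : r = 𝟙 X) : (𝟙 X ≫ m ≫ i.symm.hom) ≫ i.hom = r ≫ 𝟙 X ≫ m := by
      simp [h]
    ext x
    exact key (D := SliceColimit K'.obj) _ ((phiIso K' _).app x) _
      (CategoryTheory.Functor.map_id (colimitMap α) _)

variable (C) in
/-- The (2,1)-adjunction between `sliceColimit` and `Γ`. -/
def sliceColimitAdjunction : TwoOneAdjunction (sliceColimit C) (gamma C) where
  homEquiv K N := (transpose K.as N).asEquivalence
  naturality_left {K K' M} α F := congrArg Discrete.mk (by
    have h := unitMap_naturality α.as
    have hc := gammaMap_comp (phiMap α.as) F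
    exact (congrArg (unitMap K'.as ≫ ·) hc).trans ((Category.assoc _ _ _).symm.trans
      ((congrArg (· ≫ gammaMap F) h).trans (Category.assoc _ _ _))))
  naturality_right {K M N} F H := congrArg Discrete.mk
    ((congrArg (unitMap K.as ≫ ·) (gammaMap_comp F H)).trans (Category.assoc _ _ _).symm)

/-- `unitMap K` as an isomorphism. -/
def unitMapIso (K : LexFun κ C) : K ≅ gammaObj (phi K) := asIso (unitMap K)

variable (C) in
/-- The unit of the adjunction as a natural isomorphism `𝟭 ≅ Γ C_-`. -/
def unitIso : 𝟭 (LexFun κ C) ≅ compFunctor (sliceColimit C) (gamma C) :=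
  NatIso.ofComponents (fun K ↦ unitMapIso K) fun α ↦ (unitMap_naturality α).symm

lemma unitIso_hom_app (K : LexFun κ C) :
    (unitIso C).hom.app K = (sliceColimitAdjunction C).unit K :=
  ((congrArg (unitMap K ≫ ·) (gammaMap_id (phi K))).trans (Category.comp_id _)).symm

/-- `sliceColimit` is locally an equivalence, as the unit is an isomorphism. -/
instance (K K' : LocallyDiscrete (LexFun κ C)) :
    ((sliceColimit C).mapFunctor K K').IsEquivalence where
  faithful := ⟨fun _ ↦ Subsingleton.elim _ _⟩
  full := ⟨fun {α β} θ ↦ by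
    have h : unitMap K.as ≫ gammaMap (phiMap α.as) = unitMap K.as ≫ gammaMap (phiMap β.as) :=
      congrArg (unitMap K.as ≫ ·) (gammaMap_congr θ)
    rw [unitMap_naturality, unitMap_naturality] at h
    replace h := (cancel_mono (unitMapIso K'.as).hom).1 h
    exact ⟨Discrete.eqToHom h, Subsingleton.elim (α := phiMap α.as ⟶ phiMap β.as) _ _⟩⟩
  essSurj := ⟨fun F ↦ by
    let α : K.as ⟶ K'.as := unitMap K.as ≫ gammaMap F ≫ (unitMapIso K'.as).inv
    have h : α ≫ unitMap K'.as = unitMap K.as ≫ gammaMap F := by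
      have := (unitMapIso K'.as).inv_hom_id
      exact (Category.assoc _ _ _).trans (congrArg (_ ≫ ·) ((Category.assoc _ _ _).trans
        ((congrArg (_ ≫ ·) this).trans (Category.comp_id _))))
    exact ⟨⟨α⟩, nonempty_iso_of_gammaMap_eq (F := phiMap α) (G := F)
      ((unitMap_naturality α).trans h)⟩⟩

end Adjoint

end Diagrams

end

theorem mainTheorem2 (κ : Cardinal.{u}) [Fact κ.IsRegular] (C : Diagrams.LexCat κ) :
    ∃ L : LocallyDiscrete (Diagrams.LexFun κ C) ⥤ᵖ Diagrams.Coslice C,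
      Nonempty (Diagrams.SliceColimitData L) ∧
      (∃ (adj : Diagrams.TwoOneAdjunction L (Diagrams.gamma C))
          (η : 𝟭 (Diagrams.LexFun κ C) ≅ Diagrams.compFunctor L (Diagrams.gamma C)),
        ∀ K, η.hom.app K = adj.unit K) ∧
      ∀ K K', (L.mapFunctor K K').IsEquivalence :=
  ⟨Diagrams.sliceColimit C, ⟨Diagrams.sliceColimitData C⟩,
    ⟨Diagrams.sliceColimitAdjunction C, Diagrams.unitIso C, Diagrams.unitIso_hom_app⟩,
    fun _ _ ↦ inferInstance⟩
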